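/- In no-wait flowshop, an instance consists of $n$ jobs, $m\ge 1$ machines and processing times $t_{ji}\in\mathbb{Z}_{\ge 0}$ for $1\le j\le n$, $1\le i\le m$. Job $j$ consists of $m$ operations, the $i$-th of which has to be processed without interruption for $t_{ji}$ time units on machine $i$. A feasible (no-wait permutation) schedule assigns to each operation a starting time $S_{ji}\in[0,\infty)$ such that $S_{j,i+1}=S_{ji}+t_{ji}$ for all $j$ and all $i<m$, and such that, for some permutation $\sigma$ of the jobs, $S_{\sigma(k),i}+t_{\sigma(k),i}\le S_{\sigma(l),i}$ for all $k<l$ and all machines $i$ (operations of length zero included). Its makespan is $\max_{j,i}(S_{ji}+t_{ji})$. Let $C_{\max}(\sigma)$ be the minimum makespan of a feasible schedule with job order $\sigma$, and $C^*_{\max}=\min_\sigma C_{\max}(\sigma)$. Theorem. There is an $O(\log m)$-approximation algorithm for no-wait flowshop. That is, there are a constant $C$ and an algorithm that, given any instance (all numbers written in binary, $n$ and $m$ being part of the input), computes in time polynomial in the length of the input a permutation $\sigma$ of the jobs with $$C_{\max}(\sigma)\le \max\{1,\;C\log_2 m\}\cdot C^*_{\max}.$$ (Running time is measured on a random access machine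 with logarithmic cost, that is, every instruction is charged the number of bits of the numbers it handles.) -/

import Mathlib

open scoped NNReal

/-! ## The model of computation: while-programs on a random access machine, logarithmic cost -/

namespace RAM

/-- The memory: array number `a` holds the natural number `s a i` in its cell `i`. A program names
only finitely many arrays, but may address the cells of an array indirectly. -/
abbrev Memory : Type := ℕ → ℕ → ℕ

/-- Arithmetic expressions; `read a i` is the content of cell `i` of array `a`,
and `sub` is truncated subtraction. -/
inductive Expr : Type
  | const (c : ℕ) : Expr
  | read (a : ℕ) (i : Expr) : Expr
  | add (e f : Expr) : Expr
  | sub (e f : Expr) : Expr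
  | mul (e f : Expr) : Expr

namespace Expr

/-- The value of an expression. -/
def eval (s : Memory) : Expr → ℕ
  | const c => c
  | read a i => s a (i.eval s)
  | add e f => e.eval s + f.eval s
  | sub e f => e.eval s - f.eval s
  | mul e f => e.eval s * f.eval s

/-- The time needed to evaluate an expression: every constant, every memory access and every
arithmetic operation is charged one unit plus the number of bits of the numbers (addresses
included) that it handles. -/
def cost (s : Memory) : Expr → ℕ
  | const c => 1 + Nat.size c
  | read a i => i.cost s + (1 + Nat.size (i.eval s) + Nat.size (s a (i.eval s)))
  | add e f => e.cost s + f.cost s + (1 + Nat.size (e.eval s) + Nat.size (f.eval s))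
  | sub e f => e.cost s + f.cost s + (1 + Nat.size (e.eval s) + Nat.size (f.eval s))
  | mul e f => e.cost s + f.cost s + (1 + Nat.size (e.eval s) + Nat.size (f.eval s))

end Expr

/-- Programs; `write a i e` stores the value of `e` in cell `i` of array `a`, and a test succeeds
if the value of the tested expression is not `0`. -/
inductive Prog : Type
  | skip : Prog
  | write (a : ℕ) (i e : Expr) : Prog
  | seq (p q : Prog) : Prog
  | ite (e : Expr) (p q : Prog) : Prog
  | loop (e : Expr) (p : Prog) : Prog

/-- The memory `s` after storing `v` in cell `i` of array `a`. -/
def Memory.set (s : Memory) (a i v : ℕ) : Memory :=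
  Function.update s a (Function.update (s a) i v)

/-- `Exec p s t s'`: the program `p`, started on the memory `s`, halts with the memory `s'`
after time exactly `t`. -/
inductive Exec : Prog → Memory → ℕ → Memory → Prop
  | skip (s : Memory) : Exec Prog.skip s 1 s
  | write (s : Memory) (a : ℕ) (i e : Expr) :
      Exec (Prog.write a i e) s
        (i.cost s + e.cost s + (1 + Nat.size (i.eval s) + Nat.size (e.eval s)))
        (s.set a (i.eval s) (e.eval s))
  | seq {p q : Prog} {s s₁ s₂ : Memory} {t₁ t₂ : ℕ} :
      Exec p s t₁ s₁ → Exec q s₁ t₂ s₂ → Exec (Prog.seq p q) s (t₁ + t₂) s₂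
  | ite_true {e : Expr} {p q : Prog} {s s₁ : Memory} {t : ℕ} :
      e.eval s ≠ 0 → Exec p s t s₁ →
      Exec (Prog.ite e p q) s (e.cost s + (1 + Nat.size (e.eval s)) + t) s₁
  | ite_false {e : Expr} {p q : Prog} {s s₁ : Memory} {t : ℕ} :
      e.eval s = 0 → Exec q s t s₁ →
      Exec (Prog.ite e p q) s (e.cost s + (1 + Nat.size (e.eval s)) + t) s₁
  | loop_true {e : Expr} {p : Prog} {s s₁ s₂ : Memory} {t₁ t₂ : ℕ} :
      e.eval s ≠ 0 → Exec p s t₁ s₁ → Exec (Prog.loop e p) s₁ t₂ s₂ →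
      Exec (Prog.loop e p) s (e.cost s + (1 + Nat.size (e.eval s)) + t₁ + t₂) s₂
  | loop_false {e : Expr} {p : Prog} {s : Memory} :
      e.eval s = 0 → Exec (Prog.loop e p) s (e.cost s + (1 + Nat.size (e.eval s))) s

/-- The initial memory: the input is in array `0`, all other cells are `0`. -/
def initMem (w : List ℕ) : Memory :=
  fun a i => if a = 0 then w.getD i 0 else 0

/-- The length of an input in bits, with one separator for each number. -/
def bitLength (w : List ℕ) : ℕ :=
  (w.map fun x => Nat.size x + 1).sum

end RAM

/-! ## No-wait flowshop -/

/-- An instance of no-wait flowshop: `n` jobs, `m` machines, and the processing time `t j i` of the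
operation of job `j` on machine `i`. Zero processing times are allowed. -/
structure NoWaitFlowshop : Type where
  n : ℕ
  m : ℕ
  m_pos : 0 < m
  t : Fin n → Fin m → ℕ

namespace NoWaitFlowshop

variable (I : NoWaitFlowshop)

/-- A schedule is given by the starting times of all operations. -/
abbrev Schedule : Type := Fin I.n → Fin I.m → ℝ≥0

/-- `S` is a feasible no-wait permutation schedule in which the jobs are processed in the order
`σ 0, σ 1, …, σ (n - 1)`. -/
structure IsFeasible (σ : Equiv.Perm (Fin I.n)) (S : I.Schedule) : Prop where
  /-- Each operation of a job starts at the moment at which the preceding operation ends. -/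
  no_wait : ∀ (j : Fin I.n) (i i' : Fin I.m), (i' : ℕ) = (i : ℕ) + 1 →
    S j i' = S j i + (I.t j i : ℝ≥0)
  /-- On every machine the jobs are executed one after another in the order `σ`; this includes
  the operations of length zero. -/
  order : ∀ (i : Fin I.m) (k l : Fin I.n), k < l →
    S (σ k) i + (I.t (σ k) i : ℝ≥0) ≤ S (σ l) i

/-- The makespan of a schedule: the maximum completion time (`0` if there are no jobs). -/
noncomputable def makespan (S : I.Schedule) : ℝ≥0 :=
  Finset.univ.sup fun j => Finset.univ.sup fun i => S j i + (I.t j i : ℝ≥0)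

/-- The order `σ` is a `ρ`-approximate solution: some feasible schedule that processes the jobs in
the order `σ` has makespan at most `ρ` times the makespan of every feasible schedule. -/
def IsApproximate (ρ : ℝ) (σ : Equiv.Perm (Fin I.n)) : Prop :=
  ∃ S : I.Schedule, I.IsFeasible σ S ∧
    ∀ (τ : Equiv.Perm (Fin I.n)) (S' : I.Schedule), I.IsFeasible τ S' →
      (I.makespan S : ℝ) ≤ ρ * (I.makespan S' : ℝ)

/-- The instance as an input: `n`, `m`, and then the processing times job by job. -/
def encode : List ℕ :=
  I.n :: I.m :: (List.ofFn fun j => List.ofFn (I.t j)).flatten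

/-- The memory `s` contains the order `σ` as the output: cell `k` of array `1` holds the job in
position `k`. -/
def IsOutput (s : RAM.Memory) (σ : Equiv.Perm (Fin I.n)) : Prop :=
  ∀ k : Fin I.n, s 1 k = (σ k : ℕ)

end NoWaitFlowshop

/-- The program `P` is a polynomial-time approximation algorithm for no-wait flowshop with
performance guarantee `ρ m` on the instances with `m` machines, where the number of machines is
part of the input. -/
def IsNoWaitFlowshopApproximation (P : RAM.Prog) (ρ : ℕ → ℝ) : Prop :=
  ∃ time : Polynomial ℕ, ∀ I : NoWaitFlowshop,
    ∃ (t : ℕ) (s : RAM.Memory) (σ : Equiv.Perm (Fin I.n)),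
      RAM.Exec P (RAM.initMem I.encode) t s ∧
      t ≤ time.eval (RAM.bitLength I.encode) ∧
      I.IsOutput s σ ∧
      I.IsApproximate (ρ I.m) σ

/-!
Add a dummy job without processing time. The minimum makespan of an order of the jobs is then the
length of the corresponding closed tour, where the distance from `j` to `k` is the delay
`max i, offset j (i + 1) - offset k i` that the no-wait condition enforces between their starts. So
the problem is an asymmetric travelling salesman problem with triangle inequality.

As in the algorithm of Frieze, Galbiati and Maffioli, every round covers the active nodes by cycles
and keeps one active node of each cycle. If `T` is the length of a tour, then shortcutting it yields
a cover of length at most `T`, and an auction with integral prices finds one of length at most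
`3 * T`. The point is to keep the shortest job of each cycle: its successor is no shorter and is not
kept, so the sum of the total processing times of the active jobs is at least halved in every round.
This sum is at most `m * T` in the beginning, because each machine is busy for at most `T`. After
`⌈log₂ m⌉` rounds it is at most `T`, and the remaining cycles can be joined with that of the dummy
job at the cost of the total processing times of their active jobs. With `r` rounds the resulting
tour has length at most `(3 * r + 1) * T`, and `3 * r + 1 ≤ max 1 (7 * log₂ m)`.
-/

namespace RAM

/-! ### Polynomial time on the random access machine -/

theorem size_le_self (n : ℕ) : Nat.size n ≤ n := Nat.size_le.2 Nat.lt_two_pow_self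

theorem size_add_le (x y : ℕ) : Nat.size (x + y) ≤ max (Nat.size x) (Nat.size y) + 1 := by
  rw [Nat.size_le, pow_succ]
  have hx := (Nat.lt_size_self x).trans_le
    (Nat.pow_le_pow_right two_pos (le_max_left (Nat.size x) (Nat.size y)))
  have hy := (Nat.lt_size_self y).trans_le
    (Nat.pow_le_pow_right two_pos (le_max_right (Nat.size x) (Nat.size y)))
  omega

theorem size_mul_le (x y : ℕ) : Nat.size (x * y) ≤ Nat.size x + Nat.size y := by
  rw [Nat.size_le, pow_add]
  exact Nat.mul_lt_mul'' (Nat.lt_size_self x) (Nat.lt_size_self y)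

theorem monotone_polynomial_eval {R : Type*} [Semiring R] [PartialOrder R] [IsOrderedRing R]
    [CanonicallyOrderedAdd R] (p : Polynomial R) : Monotone fun x => p.eval x := by
  intro x y h
  simp only [Polynomial.eval_eq_sum_range]
  gcongr

namespace Memory

theorem set_of_ne (s : Memory) {a a' : ℕ} (h : a' ≠ a) (i v : ℕ) : s.set a i v a' = s a' := by
  simp [Memory.set, h]

theorem set_apply_same (s : Memory) (a i v : ℕ) :
    s.set a i v a = Function.update (s a) i v := by
  simp [Memory.set]

/-- The size of a memory: the cells `0` and `1` of the input array, which are the parameters of the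
input, are at most `R`, and every cell has at most `b` bits. -/
structure Bounded (s : Memory) (R b : ℕ) : Prop where
  fst_le : s 0 0 ≤ R
  snd_le : s 0 1 ≤ R
  size_le : ∀ a i, Nat.size (s a i) ≤ b

theorem Bounded.mono {s : Memory} {R b b' : ℕ} (h : s.Bounded R b) (hb : b ≤ b') :
    s.Bounded R b' :=
  ⟨h.fst_le, h.snd_le, fun a i => (h.size_le a i).trans hb⟩

theorem Bounded.set {s : Memory} {R b a v : ℕ} (h : s.Bounded R b) (ha : a ≠ 0) (i : ℕ)
    (hv : Nat.size v ≤ b) : (s.set a i v).Bounded R b := by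
  refine ⟨?_, ?_, fun a' i' => ?_⟩
  · simpa only [set_of_ne _ ha.symm] using h.fst_le
  · simpa only [set_of_ne _ ha.symm] using h.snd_le
  · obtain rfl | ha' := eq_or_ne a' a
    · rw [set_apply_same, Function.update_apply]
      split_ifs
      exacts [hv, h.size_le _ _]
    · rw [set_of_ne _ ha']
      exact h.size_le _ _

end Memory

namespace Expr

/-- The expressions that may bound the number of rounds of a counting loop: polynomials in the cells
`0` and `1` of the input array. -/
def isBound : Expr → Bool
  | const _ => true
  | read a (const i) => a == 0 && decide (i < 2)
  | add e f => e.isBound && f.isBound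
  | mul e f => e.isBound && f.isBound
  | _ => false

/-- The expressions that may be assigned to a cell: those whose value has only polynomially many
bits more than the numbers in memory. Products of two computed numbers are excluded, since
iterated squaring takes exponential time. -/
def isTame : Expr → Bool
  | const _ => true
  | read _ _ => true
  | add e f => e.isTame && f.isTame
  | sub e _ => e.isTame
  | mul e f => e.isBound && f.isTame

theorem eval_congr_of_isBound {s s' : Memory} (h : s 0 = s' 0) {e : Expr}
    (he : e.isBound = true) : e.eval s = e.eval s' := by
  fun_induction isBound e <;> simp_all [eval]

theorem exists_eval_le_of_isBound {e : Expr} (he : e.isBound = true) :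
    ∃ p : Polynomial ℕ, ∀ (s : Memory) (R b : ℕ), s.Bounded R b → e.eval s ≤ p.eval R := by
  fun_induction isBound e with
  | case1 c => exact ⟨Polynomial.C c, fun _ _ _ _ => by simp [eval]⟩
  | case2 a i =>
    simp only [Bool.and_eq_true, beq_iff_eq, decide_eq_true_eq] at he
    obtain ⟨rfl, hi⟩ := he
    refine ⟨Polynomial.X, fun s R b h => ?_⟩
    rw [Polynomial.eval_X]
    interval_cases i
    exacts [h.fst_le, h.snd_le]
  | case3 e f ihe ihf =>
    obtain ⟨he, hf⟩ := Bool.and_eq_true_iff.1 he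
    obtain ⟨p, hp⟩ := ihe he
    obtain ⟨q, hq⟩ := ihf hf
    refine ⟨p + q, fun s R b h => ?_⟩
    rw [Polynomial.eval_add]
    exact Nat.add_le_add (hp s R b h) (hq s R b h)
  | case4 e f ihe ihf =>
    obtain ⟨he, hf⟩ := Bool.and_eq_true_iff.1 he
    obtain ⟨p, hp⟩ := ihe he
    obtain ⟨q, hq⟩ := ihf hf
    refine ⟨p * q, fun s R b h => ?_⟩
    rw [Polynomial.eval_mul]
    exact Nat.mul_le_mul (hp s R b h) (hq s R b h)
  | case5 => cases he

theorem exists_size_eval_le_of_isTame {e : Expr} (he : e.isTame = true) :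
    ∃ p : Polynomial ℕ, ∀ (s : Memory) (R b : ℕ), s.Bounded R b →
      Nat.size (e.eval s) ≤ b + p.eval R := by
  fun_induction isTame e with
  | case1 c => exact ⟨Polynomial.C (Nat.size c), fun _ _ _ _ => by simp [eval]⟩
  | case2 a i => exact ⟨0, fun s R b h => by simpa [eval] using h.size_le _ _⟩
  | case3 e f ihe ihf =>
    obtain ⟨he, hf⟩ := Bool.and_eq_true_iff.1 he
    obtain ⟨p, hp⟩ := ihe he
    obtain ⟨q, hq⟩ := ihf hf
    refine ⟨p + q + 1, fun s R b h => (size_add_le (e.eval s) (f.eval s)).trans ?_⟩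
    have hes := hp s R b h
    have hfs := hq s R b h
    simp only [Polynomial.eval_add, Polynomial.eval_one]
    omega
  | case4 e f ihe =>
    obtain ⟨p, hp⟩ := ihe he
    exact ⟨p, fun s R b h => (Nat.size_le_size (Nat.sub_le _ _)).trans (hp s R b h)⟩
  | case5 e f ihf =>
    obtain ⟨he, hf⟩ := Bool.and_eq_true_iff.1 he
    obtain ⟨p, hp⟩ := exists_eval_le_of_isBound he
    obtain ⟨q, hq⟩ := ihf hf
    refine ⟨p + q, fun s R b h => (size_mul_le (e.eval s) (f.eval s)).trans ?_⟩
    have hes := (size_le_self _).trans (hp s R b h)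
    have hfs := hq s R b h
    rw [Polynomial.eval_add]
    omega

theorem exists_cost_le (e : Expr) : ∃ C : ℕ, ∀ (s : Memory) (b : ℕ),
    (∀ a i, Nat.size (s a i) ≤ b) → e.cost s + (1 + Nat.size (e.eval s)) ≤ C * (b + 1) := by
  induction e with
  | const c =>
    refine ⟨2 + 2 * Nat.size c, fun s b _ => ?_⟩
    simp only [eval, cost]
    nlinarith [Nat.zero_le (Nat.size c * b)]
  | read a i ihi =>
    obtain ⟨C, hC⟩ := ihi
    refine ⟨C + 3, fun s b hb => ?_⟩
    have hi := hC s b hb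
    have hread := hb a (i.eval s)
    simp only [eval, cost]
    linarith
  | add e f ihe ihf =>
    obtain ⟨C, hC⟩ := ihe
    obtain ⟨D, hD⟩ := ihf
    refine ⟨2 * C + 2 * D + 1, fun s b hb => ?_⟩
    have he := hC s b hb
    have hf := hD s b hb
    have hsize := size_add_le (e.eval s) (f.eval s)
    have hmax := max_le_add_of_nonneg (Nat.zero_le (Nat.size (e.eval s)))
      (Nat.zero_le (Nat.size (f.eval s)))
    simp only [eval, cost]
    linarith
  | sub e f ihe ihf =>
    obtain ⟨C, hC⟩ := ihe
    obtain ⟨D, hD⟩ := ihf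
    refine ⟨2 * C + 2 * D, fun s b hb => ?_⟩
    have he := hC s b hb
    have hf := hD s b hb
    have hsize := Nat.size_le_size (Nat.sub_le (e.eval s) (f.eval s))
    simp only [eval, cost]
    linarith
  | mul e f ihe ihf =>
    obtain ⟨C, hC⟩ := ihe
    obtain ⟨D, hD⟩ := ihf
    refine ⟨2 * C + 2 * D, fun s b hb => ?_⟩
    have he := hC s b hb
    have hf := hD s b hb
    have hsize := size_mul_le (e.eval s) (f.eval s)
    simp only [eval, cost]
    linarith

end Expr

theorem Exec.exists_loop {e : Expr} {p : Prog} {V W : ℕ} (n : ℕ) (u : ℕ → Memory)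
    (hne : ∀ k < n, e.eval (u k) ≠ 0) (hend : e.eval (u n) = 0)
    (htest : ∀ k ≤ n, e.cost (u k) + (1 + Nat.size (e.eval (u k))) ≤ V)
    (hbody : ∀ k < n, ∃ t, Exec p (u k) t (u (k + 1)) ∧ t ≤ W) :
    ∃ t, Exec (Prog.loop e p) (u 0) t (u n) ∧ t ≤ n * (V + W) + V := by
  induction n generalizing u with
  | zero => exact ⟨_, Exec.loop_false hend, by simpa using htest 0 le_rfl⟩
  | succ n ih =>
    obtain ⟨t, ht, htW⟩ := hbody 0 (by omega)
    obtain ⟨t', ht', htV⟩ := ih (fun k => u (k + 1)) (fun k hk => hne (k + 1) (by omega)) hend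
      (fun k hk => htest (k + 1) (by omega)) (fun k hk => hbody (k + 1) (by omega))
    refine ⟨_, Exec.loop_true (hne 0 (by omega)) ht ht', ?_⟩
    have htest0 := htest 0 (by omega)
    linarith

/-- Programs in which every loop is a counting loop: `forLoop x e p` executes `p` as many times as
the value of `e` says, and cell `0` of the array `x` holds the number of the current round. -/
inductive Cmd : Type
  | write (a : ℕ) (i e : Expr) : Cmd
  | seq (p q : Cmd) : Cmd
  | ite (e : Expr) (p q : Cmd) : Cmd
  | skip : Cmd
  | forLoop (x : ℕ) (e : Expr) (p : Cmd) : Cmd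

namespace Cmd

/-- The increment of the counter at the end of a round. -/
def next (x : ℕ) : Cmd :=
  write x (.const 0) (.add (.read x (.const 0)) (.const 1))

/-- The translation into a program of the machine. -/
def compile : Cmd → Prog
  | write a i e => Prog.write a i e
  | seq p q => Prog.seq p.compile q.compile
  | ite e p q => Prog.ite e p.compile q.compile
  | skip => Prog.skip
  | forLoop x e p => Prog.seq (Prog.write x (.const 0) (.const 0))
      (Prog.loop (.sub e (.read x (.const 0)))
        (Prog.seq p.compile
          (Prog.write x (.const 0) (.add (.read x (.const 0)) (.const 1)))))

/-- The memory before round `k` of a counting loop with counter `x` and body `f`. -/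
def iter (x : ℕ) (f : Memory → Memory) (s : Memory) : ℕ → Memory
  | 0 => s.set x 0 0
  | k + 1 => (f (iter x f s k)).set x 0 (k + 1)

/-- The memory after the execution of a program. -/
def run : Cmd → Memory → Memory
  | write a i e, s => s.set a (i.eval s) (e.eval s)
  | seq p q, s => q.run (p.run s)
  | ite e p q, s => if e.eval s ≠ 0 then p.run s else q.run s
  | skip, s => s
  | forLoop x e p, s => iter x p.run s (e.eval s)

/-- The arrays that occur as the target of an assignment. -/
def writes : Cmd → List ℕ
  | write a _ _ => [a]
  | seq p q => p.writes ++ q.writes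
  | ite _ p q => p.writes ++ q.writes
  | skip => []
  | forLoop x _ p => x :: p.writes

theorem iter_counter (x : ℕ) (f : Memory → Memory) (s : Memory) (k : ℕ) :
    iter x f s k x 0 = k := by
  cases k <;> simp [iter, Memory.set_apply_same]

theorem iter_of_ne {x a : ℕ} {f : Memory → Memory} (hx : a ≠ x) (hf : ∀ s, f s a = s a)
    (s : Memory) (k : ℕ) : iter x f s k a = s a := by
  induction k with
  | zero => exact Memory.set_of_ne _ hx _ _
  | succ k ih => rw [iter, Memory.set_of_ne _ hx, hf, ih]

theorem run_of_notMem_writes {c : Cmd} {a : ℕ} (h : a ∉ c.writes) (s : Memory) :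
    c.run s a = s a := by
  induction c generalizing s with
  | write a' i e => exact Memory.set_of_ne _ (by simpa [writes] using h) _ _
  | seq p q ihp ihq =>
    simp only [writes, List.mem_append, not_or] at h
    rw [run, ihq h.2, ihp h.1]
  | ite e p q ihp ihq =>
    simp only [writes, List.mem_append, not_or] at h
    rw [run]
    split_ifs
    exacts [ihp h.1 s, ihq h.2 s]
  | skip => rfl
  | forLoop x e p ihp =>
    simp only [writes, List.mem_cons, not_or] at h
    exact iter_of_ne h.1 (ihp h.2) _ _

theorem run_next_iter {x : ℕ} {p : Cmd} (hx : x ∉ p.writes) (s : Memory) (k : ℕ) :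
    (p.seq (next x)).run (iter x p.run s k) = iter x p.run s (k + 1) := by
  simp [run, next, Expr.eval, iter, run_of_notMem_writes hx, iter_counter]

theorem run_forLoop_induction {x : ℕ} {e : Expr} {p : Cmd} {s : Memory} (I : ℕ → Memory → Prop)
    (n : ℕ) (hn : e.eval s = n)
    (hset : ∀ k s' v, I k s' → I k (s'.set x 0 v)) (h0 : I 0 s)
    (hstep : ∀ k < n, ∀ s', s' x 0 = k →
      (∀ a, a ∉ (forLoop x e p).writes → s' a = s a) → I k s' → I (k + 1) (p.run s')) :
    I n ((forLoop x e p).run s) := by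
  have hframe : ∀ k a, a ∉ (forLoop x e p).writes → iter x p.run s k a = s a := by
    intro k a ha
    simp only [writes, List.mem_cons, not_or] at ha
    exact iter_of_ne ha.1 (run_of_notMem_writes ha.2) s k
  have hinv : ∀ k ≤ n, I k (iter x p.run s k) := by
    intro k
    induction k with
    | zero => exact fun _ => hset _ _ _ h0
    | succ k ih =>
      intro hk
      exact hset _ _ _ (hstep k hk _ (iter_counter _ _ _ _) (hframe k) (ih (by omega)))
  rw [run, hn]
  exact hinv n le_rfl

/-- A program runs in polynomial time if its running time is polynomial in the parameters and the
number of bits of the numbers in memory, and if moreover it lengthens these numbers by an amount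
that is polynomial in the parameters alone; the latter makes the notion stable under iteration. -/
def PolyTime (c : Cmd) : Prop :=
  ∃ g T : Polynomial ℕ, ∀ (s : Memory) (R b : ℕ), s.Bounded R b →
    (∃ t, Exec c.compile s t (c.run s) ∧ t ≤ T.eval (R + b)) ∧
      (c.run s).Bounded R (b + g.eval R)

theorem polyTime_skip : PolyTime skip :=
  ⟨0, 1, fun s R b h => ⟨⟨1, Exec.skip s, by simp⟩, by simpa [run] using h⟩⟩

theorem polyTime_write {a : ℕ} (i : Expr) {e : Expr} (ha : a ≠ 0) (he : e.isTame = true) :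
    PolyTime (write a i e) := by
  obtain ⟨C, hC⟩ := i.exists_cost_le
  obtain ⟨D, hD⟩ := e.exists_cost_le
  obtain ⟨g, hg⟩ := Expr.exists_size_eval_le_of_isTame he
  refine ⟨g, Polynomial.C (C + D) * (Polynomial.X + 1), fun s R b h => ⟨⟨_, Exec.write s a i e, ?_⟩,
    (h.mono (by omega)).set ha _ (hg s R b h)⟩⟩
  have hi := hC s b h.size_le
  have he := hD s b h.size_le
  simp only [Polynomial.eval_mul, Polynomial.eval_C, Polynomial.eval_add, Polynomial.eval_X,
    Polynomial.eval_one]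
  nlinarith [Nat.zero_le ((C + D) * R)]

theorem PolyTime.seq {p q : Cmd} (hp : PolyTime p) (hq : PolyTime q) : PolyTime (p.seq q) := by
  obtain ⟨g₁, T₁, hp⟩ := hp
  obtain ⟨g₂, T₂, hq⟩ := hq
  refine ⟨g₁ + g₂, T₁ + T₂.comp (Polynomial.X + g₁), fun s R b h => ?_⟩
  obtain ⟨⟨t₁, hexec₁, ht₁⟩, hb₁⟩ := hp s R b h
  obtain ⟨⟨t₂, hexec₂, ht₂⟩, hb₂⟩ := hq _ R _ hb₁
  refine ⟨⟨_, Exec.seq hexec₁ hexec₂, ?_⟩, hb₂.mono (by simp [add_assoc])⟩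
  have hg := monotone_polynomial_eval g₁ (Nat.le_add_right R b)
  have hT : T₂.eval (R + (b + g₁.eval R)) ≤ T₂.eval (R + b + g₁.eval (R + b)) :=
    monotone_polynomial_eval T₂ (by dsimp only at hg; omega)
  simp only [Polynomial.eval_add, Polynomial.eval_comp, Polynomial.eval_X]
  omega

theorem PolyTime.ite (e : Expr) {p q : Cmd} (hp : PolyTime p) (hq : PolyTime q) :
    PolyTime (ite e p q) := by
  obtain ⟨C, hC⟩ := e.exists_cost_le
  obtain ⟨g₁, T₁, hp⟩ := hp
  obtain ⟨g₂, T₂, hq⟩ := hq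
  refine ⟨g₁ + g₂, T₁ + T₂ + Polynomial.C C * (Polynomial.X + 1), fun s R b h => ?_⟩
  obtain ⟨⟨t₁, hexec₁, ht₁⟩, hb₁⟩ := hp s R b h
  obtain ⟨⟨t₂, hexec₂, ht₂⟩, hb₂⟩ := hq s R b h
  have htest : e.cost s + (1 + Nat.size (e.eval s)) ≤ C * (R + b + 1) :=
    (hC s b h.size_le).trans (by gcongr; omega)
  simp only [Polynomial.eval_mul, Polynomial.eval_C, Polynomial.eval_add, Polynomial.eval_X,
    Polynomial.eval_one]
  by_cases hs : e.eval s = 0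
  · rw [run, if_neg (not_not.2 hs)]
    exact ⟨⟨_, Exec.ite_false hs hexec₂, by omega⟩, hb₂.mono (by omega)⟩
  · rw [run, if_pos hs]
    exact ⟨⟨_, Exec.ite_true hs hexec₁, by omega⟩, hb₁.mono (by omega)⟩

theorem bounded_iter {x : ℕ} {p : Cmd} {s : Memory} {R b d : ℕ} (hx0 : x ≠ 0)
    (hx : x ∉ p.writes) (hs : s.Bounded R b)
    (hround : ∀ s b, s.Bounded R b → ((p.seq (next x)).run s).Bounded R (b + d)) (k : ℕ) :
    (iter x p.run s k).Bounded R (b + k * d) := by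
  induction k with
  | zero => exact (hs.mono (by omega)).set hx0 _ (by simp)
  | succ k ih =>
    rw [← run_next_iter hx]
    exact (hround _ _ ih).mono (by rw [Nat.succ_mul, add_assoc])

theorem eval_iter_of_isBound {x : ℕ} {e : Expr} {p : Cmd} (he : e.isBound = true)
    (h0 : 0 ∉ (forLoop x e p).writes) (s : Memory) (k : ℕ) :
    e.eval (iter x p.run s k) = e.eval s := by
  simp only [writes, List.mem_cons, not_or] at h0
  exact Expr.eval_congr_of_isBound (iter_of_ne h0.1 (run_of_notMem_writes h0.2) s k) he

theorem exec_forLoop {x : ℕ} {e : Expr} {p : Cmd} {s : Memory} {t V W : ℕ} (hx : x ∉ p.writes)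
    (he : ∀ k, e.eval (iter x p.run s k) = e.eval s)
    (hinit : Exec (Prog.write x (.const 0) (.const 0)) s t (s.set x 0 0))
    (htest : ∀ k ≤ e.eval s, (Expr.sub e (.read x (.const 0))).cost (iter x p.run s k) +
      (1 + Nat.size ((Expr.sub e (.read x (.const 0))).eval (iter x p.run s k))) ≤ V)
    (hround : ∀ k < e.eval s, ∃ t, Exec (p.seq (next x)).compile (iter x p.run s k) t
      ((p.seq (next x)).run (iter x p.run s k)) ∧ t ≤ W) :
    ∃ t', Exec (forLoop x e p).compile s t' ((forLoop x e p).run s) ∧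
      t' ≤ t + (e.eval s * (V + W) + V) := by
  have heval : ∀ k, (Expr.sub e (.read x (.const 0))).eval (iter x p.run s k) = e.eval s - k := by
    simp [Expr.eval, he, iter_counter]
  obtain ⟨t', hloop, ht'⟩ := Exec.exists_loop (e := Expr.sub e (.read x (.const 0)))
    (p := (p.seq (next x)).compile) (e.eval s) (iter x p.run s)
    (fun k hk => by rw [heval]; omega) (by rw [heval]; omega) htest
    (fun k hk => run_next_iter hx s k ▸ hround k hk)
  exact ⟨_, Exec.seq hinit hloop, by omega⟩

theorem PolyTime.forLoop {x : ℕ} {e : Expr} {p : Cmd} (he : e.isBound = true)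
    (hx : x ∉ p.writes) (h0 : 0 ∉ (forLoop x e p).writes) (hp : PolyTime p) :
    PolyTime (forLoop x e p) := by
  have hx0 : x ≠ 0 := by rintro rfl; simp [writes] at h0
  obtain ⟨q, hq⟩ := Expr.exists_eval_le_of_isBound he
  obtain ⟨C, hC⟩ := (Expr.sub e (.read x (.const 0))).exists_cost_le
  obtain ⟨_, T₀, hinit⟩ := polyTime_write (.const 0) (e := .const 0) hx0 rfl
  obtain ⟨g, T, hround⟩ := hp.seq (polyTime_write (.const 0)
    (e := .add (.read x (.const 0)) (.const 1)) hx0 rfl)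
  set P : Polynomial ℕ := Polynomial.X + q * g with hP
  refine ⟨q * g, T₀ + (q * (Polynomial.C C * (P + 1) + T.comp P) + Polynomial.C C * (P + 1)),
    fun s R b hs => ?_⟩
  set B := b + q.eval R * g.eval R with hB
  have hrounds : e.eval s ≤ q.eval R := hq s R b hs
  have hiter : ∀ k ≤ e.eval s, (iter x p.run s k).Bounded R B := fun k hk =>
    (bounded_iter hx0 hx hs (fun s b h => (hround s R b h).2) k).mono (by
      rw [hB]; gcongr; omega)
  have hPB : R + B ≤ P.eval (R + b) := by
    have hmul := Nat.mul_le_mul (monotone_polynomial_eval q (Nat.le_add_right R b))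
      (monotone_polynomial_eval g (Nat.le_add_right R b))
    simp only [hP, hB, Polynomial.eval_add, Polynomial.eval_X, Polynomial.eval_mul] at hmul ⊢
    omega
  obtain ⟨⟨t, ht, htT⟩, -⟩ := hinit s R b hs
  obtain ⟨t', hexec, ht'⟩ := exec_forLoop hx (eval_iter_of_isBound he h0 s) ht
    (fun k hk => hC _ B (hiter k hk).size_le)
    (fun k hk => (hround _ R B (hiter k hk.le)).1.imp fun t h =>
      ⟨h.1, h.2.trans (monotone_polynomial_eval T hPB)⟩)
  refine ⟨⟨t', hexec, ht'.trans ?_⟩, hiter _ le_rfl |>.mono (by simp [hB])⟩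
  simp only [Polynomial.eval_add, Polynomial.eval_mul, Polynomial.eval_C, Polynomial.eval_one,
    Polynomial.eval_comp]
  have hq' : e.eval s ≤ q.eval (R + b) :=
    hrounds.trans (monotone_polynomial_eval q (Nat.le_add_right R b))
  gcongr <;> omega

/-- Loop counters are not changed by the body, the numbers of rounds are polynomial in the
parameters, and all assignments are tame. -/
def wf : Cmd → Bool
  | write _ _ e => e.isTame
  | seq p q => p.wf && q.wf
  | ite _ p q => p.wf && q.wf
  | skip => true
  | forLoop x e p => e.isBound && !(p.writes.contains x) && p.wf

theorem polyTime_of_wf {c : Cmd} (hc : c.wf = true) (h0 : 0 ∉ c.writes) : PolyTime c := by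
  induction c with
  | write a i e => exact polyTime_write i (by simpa [writes, eq_comm] using h0) hc
  | seq p q ihp ihq =>
    simp only [wf, Bool.and_eq_true] at hc
    simp only [writes, List.mem_append, not_or] at h0
    exact (ihp hc.1 h0.1).seq (ihq hc.2 h0.2)
  | ite e p q ihp ihq =>
    simp only [wf, Bool.and_eq_true] at hc
    simp only [writes, List.mem_append, not_or] at h0
    exact (ihp hc.1 h0.1).ite e (ihq hc.2 h0.2)
  | skip => exact polyTime_skip
  | forLoop x e p ihp =>
    simp only [wf, Bool.and_eq_true, Bool.not_eq_true', List.contains_eq_mem,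
      decide_eq_false_iff_not] at hc
    exact PolyTime.forLoop hc.1.1 hc.1.2 h0
      (ihp hc.2 fun h => h0 (List.mem_cons_of_mem x h))

end Cmd

end RAM

/-! ### The auction algorithm for the assignment problem -/

/-- A partial assignment of `N` objects to `N` persons: `asg i = j + 1` if person `i` holds object
`j`, and `asg i = 0` if `i` holds nothing. -/
structure IsPartialAssignment (N : ℕ) (asg : ℕ → ℕ) : Prop where
  le : ∀ i < N, asg i ≤ N
  inj : ∀ i < N, ∀ i' < N, asg i ≠ 0 → asg i = asg i' → i = i'

/-- The invariant of the auction with cost matrix `c`: object `j` has the price `k j * E`, every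
assigned person holds an object that is cheapest up to `E`, every object with a positive price is
assigned, and no price exceeds `B + E`. -/
structure AuctionInv (N E B : ℕ) (c : ℕ → ℕ → ℕ) (asg k : ℕ → ℕ) : Prop
    extends IsPartialAssignment N asg where
  slack : ∀ i < N, ∀ j < N, asg i = j + 1 → ∀ j' < N, c i j + k j * E ≤ c i j' + k j' * E + E
  owned : ∀ j < N, k j ≠ 0 → ∃ i < N, asg i = j + 1
  price : ∀ j < N, k j * E ≤ B + E

/-- The unassigned person `i` bids for the object `b`, which is cheapest for `i` at the current
prices, and takes it from its holder; this turns `asg` into `asg'`, while the price of `b` rises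
to `(k b + 1) * E`. -/
structure IsBid (N E : ℕ) (c : ℕ → ℕ → ℕ) (asg k : ℕ → ℕ) (i b : ℕ) (asg' : ℕ → ℕ) : Prop where
  person_lt : i < N
  object_lt : b < N
  unassigned : asg i = 0
  cheapest : ∀ j < N, c i b + k b * E ≤ c i j + k j * E
  apply_self : asg' i = b + 1
  apply_of_ne : ∀ i' < N, i' ≠ i → asg' i' = if asg i' = b + 1 then 0 else asg i'

namespace IsBid

variable {N E B : ℕ} {c : ℕ → ℕ → ℕ} {asg k asg' : ℕ → ℕ} {i b : ℕ}

theorem isPartialAssignment (hb : IsBid N E c asg k i b asg') (h : IsPartialAssignment N asg) :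
    IsPartialAssignment N asg' where
  le i' hi' := by
    have := hb.object_lt
    obtain rfl | hne := eq_or_ne i' i
    · rw [hb.apply_self]
      omega
    · rw [hb.apply_of_ne i' hi' hne]
      split_ifs
      exacts [Nat.zero_le N, h.le i' hi']
  inj i₁ h₁ i₂ h₂ hne heq := by
    by_cases e₁ : i₁ = i <;> by_cases e₂ : i₂ = i
    · rw [e₁, e₂]
    · rw [e₁, hb.apply_self, hb.apply_of_ne i₂ h₂ e₂] at heq
      split_ifs at heq with hs
      exact absurd heq.symm hs
    · rw [e₂, hb.apply_self, hb.apply_of_ne i₁ h₁ e₁] at heq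
      split_ifs at heq with hs
      exact absurd heq hs
    · rw [hb.apply_of_ne i₁ h₁ e₁] at hne heq
      rw [hb.apply_of_ne i₂ h₂ e₂] at heq
      split_ifs at hne heq
      exacts [absurd rfl hne, absurd rfl hne, absurd heq hne, h.inj i₁ h₁ i₂ h₂ hne heq]

theorem le_update (k : ℕ → ℕ) (b j : ℕ) : k j ≤ Function.update k b (k b + 1) j := by
  obtain rfl | hj := eq_or_ne j b
  · simp
  · simp [hj]

theorem slack (hb : IsBid N E c asg k i b asg') (h : AuctionInv N E B c asg k) {i' j : ℕ}
    (hi' : i' < N) (hj : j < N) (hij : asg' i' = j + 1) {j' : ℕ} (hj' : j' < N) :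
    c i' j + Function.update k b (k b + 1) j * E ≤
      c i' j' + Function.update k b (k b + 1) j' * E + E := by
  have hmono : k j' * E ≤ Function.update k b (k b + 1) j' * E :=
    Nat.mul_le_mul_right E (le_update k b j')
  obtain rfl | hne := eq_or_ne i' i
  · obtain rfl : b = j := by simpa [hb.apply_self] using hij
    have hcheap := hb.cheapest j' hj'
    rw [Function.update_self, Nat.succ_mul]
    omega
  · rw [hb.apply_of_ne i' hi' hne] at hij
    split_ifs at hij with hs
    have hslack := h.slack i' hi' j hj hij j' hj'
    rw [Function.update_of_ne (by rintro rfl; exact hs hij)]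
    omega

theorem owned (hb : IsBid N E c asg k i b asg') (h : AuctionInv N E B c asg k) {j : ℕ}
    (hj : j < N) (hkj : Function.update k b (k b + 1) j ≠ 0) : ∃ i' < N, asg' i' = j + 1 := by
  obtain rfl | hjb := eq_or_ne j b
  · exact ⟨i, hb.person_lt, hb.apply_self⟩
  · rw [Function.update_of_ne hjb] at hkj
    obtain ⟨i', hi', heq⟩ := h.owned j hj hkj
    have hne : i' ≠ i := by
      rintro rfl
      simp [hb.unassigned] at heq
    exact ⟨i', hi', by rw [hb.apply_of_ne i' hi' hne, if_neg (by omega), heq]⟩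

theorem sum_update (hb : IsBid N E c asg k i b asg') :
    ∑ j ∈ Finset.range N, Function.update k b (k b + 1) j = ∑ j ∈ Finset.range N, k j + 1 := by
  rw [Finset.sum_update_of_mem (Finset.mem_range.2 hb.object_lt), Finset.sdiff_singleton_eq_erase,
    ← Finset.add_sum_erase _ _ (Finset.mem_range.2 hb.object_lt)]
  ring

end IsBid

namespace AuctionInv

variable {N E B : ℕ} {c : ℕ → ℕ → ℕ} {asg k asg' : ℕ → ℕ}

theorem initial (ha : ∀ i < N, asg i = 0) (hk : ∀ j < N, k j = 0) :
    AuctionInv N E B c asg k where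
  le i hi := by simp [ha i hi]
  inj i hi _ _ h := absurd (ha i hi) h
  slack i hi j _ h := by simp [ha i hi] at h
  owned j hj h := absurd (hk j hj) h
  price j hj := by simp [hk j hj]

theorem exists_price_eq_zero (h : AuctionInv N E B c asg k) {i : ℕ} (hi : i < N)
    (h0 : asg i = 0) : ∃ j < N, k j = 0 := by
  by_contra! hk
  have howned : ∀ j < N, ∃ i < N, asg i = j + 1 := fun j hj => h.owned j hj (hk j hj)
  choose! f hf hasg using howned
  have hmaps : ∀ j ∈ Finset.range N, f j ∈ (Finset.range N).erase i := by
    intro j hj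
    rw [Finset.mem_range] at hj
    rw [Finset.mem_erase, Finset.mem_range]
    refine ⟨fun hfi => ?_, hf j hj⟩
    simpa [hfi, h0] using hasg j hj
  have hinj : Set.InjOn f (Finset.range N : Set ℕ) := by
    intro j hj j' hj' hff
    have hjj := hasg j (by simpa using hj)
    rw [hff, hasg j' (by simpa using hj')] at hjj
    omega
  have hcard := Finset.card_le_card_of_injOn f hmaps hinj
  rw [Finset.card_erase_of_mem (Finset.mem_range.2 hi), Finset.card_range] at hcard
  omega

theorem bid (h : AuctionInv N E B c asg k) (hc : ∀ i < N, ∀ j < N, c i j ≤ B) {i b : ℕ}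
    (hb : IsBid N E c asg k i b asg') :
    AuctionInv N E B c asg' (Function.update k b (k b + 1)) where
  toIsPartialAssignment := hb.isPartialAssignment h.toIsPartialAssignment
  slack _ hi' _ hj hij _ hj' := hb.slack h hi' hj hij hj'
  owned _ hj hkj := hb.owned h hj hkj
  price j hj := by
    obtain rfl | hjb := eq_or_ne j b
    · obtain ⟨j₀, hj₀, hz⟩ := h.exists_price_eq_zero hb.person_lt hb.unassigned
      have hcheap := hb.cheapest j₀ hj₀
      have hcost := hc i hb.person_lt j₀ hj₀
      rw [hz] at hcheap
      rw [Function.update_self, Nat.succ_mul]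
      omega
    · rw [Function.update_of_ne hjb]
      exact h.price j hj

theorem sum_slack (h : AuctionInv N E B c asg k) {π : Equiv.Perm (Fin N)}
    (hπ : ∀ i : Fin N, asg i = π i + 1) (τ : Equiv.Perm (Fin N)) :
    ∑ i : Fin N, c i (π i) ≤ ∑ i : Fin N, c i (τ i) + N * E := by
  have hsum : ∑ i : Fin N, (c i (π i) + k (π i) * E) ≤
      ∑ i : Fin N, (c i (τ i) + k (τ i) * E + E) :=
    Finset.sum_le_sum fun i _ => h.slack i i.2 _ (π i).2 (hπ i) _ (τ i).2
  -- both assignments use every object once, so the prices cancel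
  rw [Finset.sum_add_distrib, Finset.sum_add_distrib, Finset.sum_add_distrib,
    Equiv.sum_comp π (fun j : Fin N => k j * E), Equiv.sum_comp τ (fun j : Fin N => k j * E)]
    at hsum
  simp only [Finset.sum_const, Finset.card_univ, Fintype.card_fin, smul_eq_mul] at hsum
  omega

theorem sum_le {A : ℕ} (h : AuctionInv N E (A * E) c asg k) (hE : 0 < E) :
    ∑ j ∈ Finset.range N, k j ≤ N * (A + 1) := by
  have hprice : ∀ j ∈ Finset.range N, k j ≤ A + 1 := fun j hj =>
    Nat.le_of_mul_le_mul_right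
      ((h.price j (Finset.mem_range.1 hj)).trans_eq (Nat.succ_mul A E).symm) hE
  simpa using Finset.sum_le_card_nsmul _ _ _ hprice

end AuctionInv

theorem IsPartialAssignment.exists_perm {N : ℕ} {asg : ℕ → ℕ} (h : IsPartialAssignment N asg)
    (hall : ∀ i < N, asg i ≠ 0) : ∃ π : Equiv.Perm (Fin N), ∀ i : Fin N, asg i = π i + 1 := by
  have hlt : ∀ i : Fin N, asg i - 1 < N := fun i => by
    have := h.le i i.2
    have := hall i i.2
    omega
  have hinj : Function.Injective fun i : Fin N => (⟨asg i - 1, hlt i⟩ : Fin N) := by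
    intro i i' heq
    have := hall i i.2
    have := hall i' i'.2
    have hpred : asg i - 1 = asg i' - 1 := by simpa using heq
    exact Fin.ext (h.inj i i.2 i' i'.2 (hall i i.2) (by omega))
  refine ⟨Equiv.ofBijective _ (Finite.injective_iff_bijective.1 hinj), fun i => ?_⟩
  have := hall i i.2
  rw [Equiv.ofBijective_apply]
  dsimp only
  omega

/-! ### Arcs, tours and cycles of permutations -/

open Equiv (swap)

section ArcCost

variable {V M : Type*} [Fintype V] [AddCommMonoid M]

/-- The total length of the arcs `x → π x` with respect to the distances `d`. -/
def arcCost (d : V → V → M) (π : Equiv.Perm V) : M := ∑ x, d x (π x)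

theorem arcCost_one {d : V → V → M} (hd : ∀ x, d x x = 0) : arcCost d 1 = 0 := by
  simp [arcCost, hd]

theorem arcCost_swap [DecidableEq V] {d : V → V → M} (hd : ∀ x, d x x = 0) (a b : V) :
    arcCost d (swap a b) = d a b + d b a := by
  obtain rfl | hab := eq_or_ne a b
  · simp [arcCost, hd]
  · rw [arcCost, ← Finset.sum_subset (Finset.subset_univ {a, b}), Finset.sum_pair hab]
    · simp
    · intro x _ hx
      simp only [Finset.mem_insert, Finset.mem_singleton, not_or] at hx
      rw [Equiv.swap_apply_of_ne_of_ne hx.1 hx.2, hd]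

variable [PartialOrder M] [IsOrderedAddMonoid M]

theorem arcCost_mul_le {d : V → V → M} (htri : ∀ x y z, d x z ≤ d x y + d y z)
    (π ν : Equiv.Perm V) : arcCost d (π * ν) ≤ arcCost d π + arcCost d ν := by
  have hπ : arcCost d π = ∑ x, d (ν x) (π (ν x)) := (Equiv.sum_comp ν fun y => d y (π y)).symm
  rw [hπ, arcCost, arcCost, ← Finset.sum_add_distrib]
  refine Finset.sum_le_sum fun x _ => ?_
  rw [Equiv.Perm.mul_apply, add_comm]
  exact htri _ _ _

/-- `swap a (f a) * f` fixes `a` and maps the predecessor of `a` to the successor of `a`. -/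
theorem arcCost_swap_mul_le [DecidableEq V] {d : V → V → M} (hd : ∀ x, d x x = 0)
    (htri : ∀ x y z, d x z ≤ d x y + d y z) (f : Equiv.Perm V) (a : V) :
    arcCost d (swap a (f a) * f) ≤ arcCost d f := by
  obtain ⟨y, hy⟩ := f.surjective a
  obtain rfl | hya := eq_or_ne y a
  · rw [hy, Equiv.swap_self, ← Equiv.Perm.one_def, one_mul]
  have hrest : ∀ x ∈ (Finset.univ.erase a).erase y, d x ((swap a (f a) * f) x) = d x (f x) := by
    intro x hx
    simp only [Finset.mem_erase, Finset.mem_univ, and_true] at hx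
    rw [Equiv.Perm.mul_apply, Equiv.swap_apply_of_ne_of_ne (hy ▸ f.injective.ne hx.1)
      (f.injective.ne hx.2)]
  have hsplit : ∀ g : V → M, ∑ x, g x = g a + (g y + ∑ x ∈ (Finset.univ.erase a).erase y, g x) := by
    intro g
    rw [Finset.add_sum_erase _ _ (Finset.mem_erase.2 ⟨hya, Finset.mem_univ y⟩),
      Finset.add_sum_erase _ _ (Finset.mem_univ a)]
  rw [arcCost, arcCost, hsplit, hsplit fun x => d x (f x), Finset.sum_congr rfl hrest]
  simp only [Equiv.Perm.mul_apply, hy, Equiv.swap_apply_right, Equiv.swap_apply_left, hd, zero_add]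
  rw [← add_assoc, add_comm (d a (f a))]
  gcongr
  exact htri y a (f a)

end ArcCost

section Tour

variable {V α : Type*} [Preorder α]

/-- `f` is a tour through `A` along the positions `pos`: it fixes the points outside `A`, and from
every point of `A` other than `root` it goes on to a later position or returns to `root`. -/
structure IsTourAlong (pos : V → α) (root : V) (A : Finset V) (f : Equiv.Perm V) : Prop where
  apply_of_notMem : ∀ x ∉ A, f x = x
  lt_or_eq_root : ∀ x ∈ A, x ≠ root → pos x < pos (f x) ∨ f x = root

namespace IsTourAlong

variable {pos : V → α} {root : V} {A : Finset V} {f : Equiv.Perm V}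

theorem apply_ne (h : IsTourAlong pos root A f) {x : V} (hx : x ∈ A) (hroot : x ≠ root) :
    f x ≠ x := by
  intro hfx
  rcases h.lt_or_eq_root x hx hroot with hlt | heq
  · exact lt_irrefl _ (hfx ▸ hlt)
  · exact hroot (hfx.symm.trans heq)

variable [DecidableEq V]

theorem erase (h : IsTourAlong pos root A f) {a : V} (ha : a ∈ A) (haroot : a ≠ root) :
    IsTourAlong pos root (A.erase a) (swap a (f a) * f) where
  apply_of_notMem x hx := by
    rw [Equiv.Perm.mul_apply]
    obtain rfl | hxa := eq_or_ne x a
    · exact Equiv.swap_apply_right _ _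
    · have hfx := h.apply_of_notMem x fun hxA => hx (Finset.mem_erase.2 ⟨hxa, hxA⟩)
      exact (Equiv.swap_apply_of_ne_of_ne (hfx.symm ▸ hxa) (f.injective.ne hxa)).trans hfx
  lt_or_eq_root x hx hxroot := by
    obtain ⟨hxa, hxA⟩ := Finset.mem_erase.1 hx
    have hpos := h.lt_or_eq_root x hxA hxroot
    rw [Equiv.Perm.mul_apply]
    by_cases hfx : f x = a
    · rw [hfx, Equiv.swap_apply_left]
      rw [hfx] at hpos
      exact (h.lt_or_eq_root a ha haroot).imp_left (hpos.resolve_right haroot).trans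
    · rwa [Equiv.swap_apply_of_ne_of_ne hfx (f.injective.ne hxa)]

theorem exists_sdiff [Fintype V] {M : Type*} [AddCommMonoid M] [PartialOrder M]
    [IsOrderedAddMonoid M] {d : V → V → M} (h : IsTourAlong pos root A f) (hd : ∀ x, d x x = 0)
    (htri : ∀ x y z, d x z ≤ d x y + d y z) (R : Finset V) (hR : root ∉ R) :
    ∃ g, IsTourAlong pos root (A \ R) g ∧ arcCost d g ≤ arcCost d f := by
  induction R using Finset.induction_on with
  | empty => exact ⟨f, by rwa [Finset.sdiff_empty], le_rfl⟩
  | insert a R _ ih =>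
    simp only [Finset.mem_insert, not_or] at hR
    obtain ⟨g, hg, hcost⟩ := ih hR.2
    rw [Finset.sdiff_insert]
    by_cases ha : a ∈ A \ R
    · exact ⟨_, hg.erase ha (Ne.symm hR.1), (arcCost_swap_mul_le hd htri g a).trans hcost⟩
    · rw [Finset.erase_eq_of_notMem ha]
      exact ⟨g, hg, hcost⟩

end IsTourAlong

end Tour

section CycleTransversal

open Equiv.Perm (SameCycle sameCycle_apply_right)

variable {V : Type*}

theorem perm_apply_mem {π : Equiv.Perm V} {A : Finset V} (hπ : ∀ x ∉ A, π x = x) {x : V}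
    (hx : x ∈ A) : π x ∈ A := by
  by_contra hn
  exact hn ((π.injective (hπ _ hn)).symm ▸ hx)

theorem sameCycle_induction [Finite V] {f : Equiv.Perm V} {a b : V} (h : SameCycle f a b)
    {P : V → Prop} (h0 : P a) (hs : ∀ x, P x → P (f x)) : P b := by
  obtain ⟨i, rfl⟩ := h.exists_nat_pow_eq
  clear h
  induction i with
  | zero => exact h0
  | succ i ih =>
    rw [pow_succ', Equiv.Perm.mul_apply]
    exact hs _ ih

theorem sameCycle_iff_exists_pow_lt_card [Fintype V] {f : Equiv.Perm V} {a b : V} :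
    SameCycle f a b ↔ ∃ i < Fintype.card V, (f ^ i) a = b := by
  classical
  refine ⟨fun h => ?_, fun ⟨i, _, hi⟩ => ⟨i, by simpa using hi⟩⟩
  by_cases ha : a ∈ f.support
  · obtain ⟨i, hi, hab⟩ := h.exists_pow_eq_of_mem_support ha
    exact ⟨i, hi.trans_le (Finset.card_le_univ _), hab⟩
  · rw [Equiv.Perm.notMem_support] at ha
    exact ⟨0, Fintype.card_pos_iff.2 ⟨a⟩, h.eq_of_left ha⟩

/-- The subset `A` of `B` contains exactly one element of every cycle of `π` that meets `B`. -/
structure IsCycleTransversal (π : Equiv.Perm V) (B A : Finset V) : Prop where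
  subset : A ⊆ B
  exists_sameCycle : ∀ x ∈ B, ∃ a ∈ A, SameCycle π a x
  eq_of_sameCycle : ∀ a ∈ A, ∀ b ∈ A, SameCycle π a b → a = b

theorem isCycleTransversal_one (B : Finset V) : IsCycleTransversal (1 : Equiv.Perm V) B B where
  subset := Finset.Subset.refl B
  exists_sameCycle x hx := ⟨x, hx, SameCycle.refl _ _⟩
  eq_of_sameCycle a _ b _ h := by simpa using h

theorem isCycleTransversal_swap [DecidableEq V] {A : Finset V} {a b : V} (ha : a ∈ A)
    (hb : b ∈ A) (hab : a ≠ b) : IsCycleTransversal (swap a b) A (A.erase a) where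
  subset := Finset.erase_subset _ _
  exists_sameCycle x hx := by
    obtain rfl | hxa := eq_or_ne x a
    · exact ⟨b, Finset.mem_erase.2 ⟨hab.symm, hb⟩, 1, by simp⟩
    · exact ⟨x, Finset.mem_erase.2 ⟨hxa, hx⟩, SameCycle.refl _ _⟩
  eq_of_sameCycle x hx y hy hxy := by
    have hfix : ∀ z ∈ A.erase a, z ≠ b → swap a b z = z := fun z hz hzb =>
      Equiv.swap_apply_of_ne_of_ne (Finset.mem_erase.1 hz).1 hzb
    by_cases hxb : x = b
    · by_cases hyb : y = b
      · rw [hxb, hyb]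
      · exact hxy.eq_of_right (hfix y hy hyb)
    · exact hxy.eq_of_left (hfix x hx hxb)

theorem isCycleTransversal_filter_le [Finite V] {α : Type*} [LinearOrder α] {key : V → α}
    (hkey : Function.Injective key) {π : Equiv.Perm V} {A : Finset V} (hπ : ∀ x ∉ A, π x = x)
    [DecidablePred fun a => ∀ b, SameCycle π a b → key a ≤ key b] :
    IsCycleTransversal π A (A.filter fun a => ∀ b, SameCycle π a b → key a ≤ key b) where
  subset := Finset.filter_subset _ _
  exists_sameCycle x hx := by
    classical
    have := Fintype.ofFinite V
    obtain ⟨a, ha, hmin⟩ := Finset.exists_min_image (Finset.univ.filter fun b => SameCycle π x b)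
      key ⟨x, by simp [SameCycle.refl]⟩
    simp only [Finset.mem_filter, Finset.mem_univ, true_and] at ha hmin
    exact ⟨a, Finset.mem_filter.2 ⟨sameCycle_induction ha hx fun _ => perm_apply_mem hπ,
      fun b hab => hmin b (ha.trans hab)⟩, ha.symm⟩
  eq_of_sameCycle a ha b hb hab :=
    hkey (((Finset.mem_filter.1 ha).2 b hab).antisymm ((Finset.mem_filter.1 hb).2 a hab.symm))

namespace IsCycleTransversal

variable [Fintype V] {π ν : Equiv.Perm V} {A A' : Finset V}

theorem sameCycle_mul (h : IsCycleTransversal ν Finset.univ A) (hπ : ∀ x ∉ A, π x = x) {a x : V}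
    (ha : a ∈ A) (hax : SameCycle ν a x) : SameCycle (π * ν) a x := by
  refine (sameCycle_induction hax (P := fun x => SameCycle ν a x ∧ SameCycle (π * ν) a x)
    ⟨SameCycle.refl _ _, SameCycle.refl _ _⟩ ?_).2
  rintro y ⟨hν, hmul⟩
  have hνy : SameCycle ν a (ν y) := sameCycle_apply_right.2 hν
  refine ⟨hνy, ?_⟩
  by_cases hy : ν y ∈ A
  · rw [← h.eq_of_sameCycle a ha _ hy hνy]
  · have heq : (π * ν) y = ν y := hπ _ hy
    exact heq ▸ sameCycle_apply_right.2 hmul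

theorem sameCycle_mul_apply (h : IsCycleTransversal ν Finset.univ A) (hπ : ∀ x ∉ A, π x = x)
    {a : V} (ha : a ∈ A) : SameCycle (π * ν) a (π a) := by
  obtain ⟨y, hy⟩ := ν.surjective a
  have hay : SameCycle ν a y := by rw [← sameCycle_apply_right, hy]
  have heq : (π * ν) y = π a := congrArg π hy
  exact heq ▸ sameCycle_apply_right.2 (h.sameCycle_mul hπ ha hay)

theorem exists_sameCycle_of_mul (h : IsCycleTransversal ν Finset.univ A)
    (hπ : ∀ x ∉ A, π x = x) {a x : V} (ha : a ∈ A) (hax : SameCycle (π * ν) a x) :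
    ∃ c ∈ A, SameCycle ν c x ∧ SameCycle π a c := by
  refine sameCycle_induction hax (P := fun x => ∃ c ∈ A, SameCycle ν c x ∧ SameCycle π a c)
    ⟨a, ha, SameCycle.refl _ _, SameCycle.refl _ _⟩ ?_
  rintro y ⟨c, hc, hcy, hac⟩
  have hcνy : SameCycle ν c (ν y) := sameCycle_apply_right.2 hcy
  rw [Equiv.Perm.mul_apply]
  by_cases hy : ν y ∈ A
  · rw [← h.eq_of_sameCycle c hc _ hy hcνy]
    exact ⟨π c, perm_apply_mem hπ hc, SameCycle.refl _ _, sameCycle_apply_right.2 hac⟩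
  · rw [hπ _ hy]
    exact ⟨c, hc, hcνy, hac⟩

/-- As `π` permutes representatives of the cycles of `ν`, `π * ν` joins these cycles along the
cycles of `π`. -/
theorem mul (h : IsCycleTransversal ν Finset.univ A) (hπ : ∀ x ∉ A, π x = x)
    (h' : IsCycleTransversal π A A') : IsCycleTransversal (π * ν) Finset.univ A' where
  subset := Finset.subset_univ _
  exists_sameCycle x _ := by
    obtain ⟨a, ha, hax⟩ := h.exists_sameCycle x (Finset.mem_univ x)
    obtain ⟨a', ha', haa⟩ := h'.exists_sameCycle a ha
    refine ⟨a', ha', SameCycle.trans ?_ (h.sameCycle_mul hπ ha hax)⟩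
    refine (sameCycle_induction haa (P := fun x => x ∈ A ∧ SameCycle (π * ν) a' x)
      ⟨h'.subset ha', SameCycle.refl _ _⟩ ?_).2
    rintro y ⟨hy, hay⟩
    exact ⟨perm_apply_mem hπ hy, hay.trans (h.sameCycle_mul_apply hπ hy)⟩
  eq_of_sameCycle a ha b hb hab := by
    obtain ⟨c, hc, hcb, hac⟩ := h.exists_sameCycle_of_mul hπ (h'.subset ha) hab
    obtain rfl := h.eq_of_sameCycle c hc b (h'.subset hb) hcb
    exact h'.eq_of_sameCycle a ha c hb hac

end IsCycleTransversal

end CycleTransversal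

/-! ### No-wait flowshop as a travelling salesman problem -/

namespace NoWaitFlowshop

/-- The nodes of the travelling salesman problem: the jobs and the dummy job `Fin.last n`, all of
whose operations have length zero. -/
abbrev Node (I : NoWaitFlowshop) : Type := Fin (I.n + 1)

variable (I : NoWaitFlowshop)

/-- The processing times, extended by zero; in particular `time n` are those of the dummy job. -/
def time (j i : ℕ) : ℕ := if h : j < I.n ∧ i < I.m then I.t ⟨j, h.1⟩ ⟨i, h.2⟩ else 0

/-- The time from the start of job `j` to the start of its operation on machine `i`; for `i = m`
this is the total processing time of the job. -/
def offset (j i : ℕ) : ℕ := ∑ l ∈ Finset.range i, I.time j l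

/-- The least difference of the starting times of job `j` and of a later job `k`. -/
def delay (j k : ℕ) : ℕ := (Finset.range I.m).sup fun i => I.offset j (i + 1) - I.offset k i

/-- The distances of the travelling salesman problem: the delays, with zeros on the diagonal. -/
def dist (x y : I.Node) : ℕ := if x = y then 0 else I.delay x y

variable {I}

theorem time_of_le {j : ℕ} (h : I.n ≤ j) (i : ℕ) : I.time j i = 0 :=
  dif_neg fun h' => by omega

theorem time_fin (j : Fin I.n) (i : Fin I.m) : I.time j i = I.t j i := dif_pos ⟨j.2, i.2⟩

theorem offset_succ (j i : ℕ) : I.offset j (i + 1) = I.offset j i + I.time j i :=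
  Finset.sum_range_succ _ _

theorem offset_mono (j : ℕ) : Monotone (I.offset j) := fun _ _ h =>
  Finset.sum_le_sum_of_subset (by simpa using h)

theorem offset_of_le {j : ℕ} (h : I.n ≤ j) (i : ℕ) : I.offset j i = 0 :=
  Finset.sum_eq_zero fun _ _ => time_of_le h _

theorem offset_last (i : ℕ) : I.offset (Fin.last I.n) i = 0 := offset_of_le le_rfl i

theorem offset_succ_le_add_delay (j k : ℕ) {i : ℕ} (hi : i < I.m) :
    I.offset j (i + 1) ≤ I.offset k i + I.delay j k :=
  Nat.sub_le_iff_le_add'.1 <|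
    Finset.le_sup (f := fun i => I.offset j (i + 1) - I.offset k i) (Finset.mem_range.2 hi)

theorem delay_le {j k b : ℕ} (h : ∀ i < I.m, I.offset j (i + 1) ≤ I.offset k i + b) :
    I.delay j k ≤ b :=
  Finset.sup_le fun i hi => Nat.sub_le_iff_le_add'.2 (h i (Finset.mem_range.1 hi))

theorem delay_le_offset (j k : ℕ) : I.delay j k ≤ I.offset j I.m :=
  delay_le fun _ hi => le_add_left (offset_mono j hi)

theorem delay_of_le_right (j : ℕ) {k : ℕ} (h : I.n ≤ k) : I.delay j k = I.offset j I.m := by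
  refine (delay_le_offset j k).antisymm ?_
  have hlast := offset_succ_le_add_delay j k (Nat.sub_one_lt_of_lt I.m_pos)
  rwa [Nat.sub_add_cancel I.m_pos, offset_of_le h, zero_add] at hlast

theorem delay_triangle (i j k : ℕ) : I.delay i k ≤ I.delay i j + I.delay j k :=
  delay_le fun q hq => by
    have hij := offset_succ_le_add_delay i j hq
    have hjk := offset_succ_le_add_delay j k hq
    have hj := I.offset_mono j (Nat.le_add_right q 1)
    omega

theorem dist_self (x : I.Node) : I.dist x x = 0 := if_pos rfl

theorem dist_of_ne {x y : I.Node} (h : x ≠ y) : I.dist x y = I.delay x y := if_neg h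

theorem dist_le_delay (x y : I.Node) : I.dist x y ≤ I.delay x y := by
  rw [dist]
  split_ifs
  exacts [Nat.zero_le _, le_rfl]

theorem dist_le_offset (x y : I.Node) : I.dist x y ≤ I.offset x I.m :=
  (dist_le_delay x y).trans (delay_le_offset _ _)

theorem dist_last_right (x : I.Node) : I.dist x (Fin.last _) = I.offset x I.m := by
  obtain rfl | h := eq_or_ne x (Fin.last _)
  · rw [dist_self, offset_last]
  · rw [dist_of_ne h, delay_of_le_right _ (Fin.val_last _).ge]

theorem dist_last_left (x : I.Node) : I.dist (Fin.last _) x = 0 :=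
  Nat.le_zero.1 (offset_last (I := I) I.m ▸ dist_le_offset (Fin.last _) x)

theorem dist_triangle (x y z : I.Node) : I.dist x z ≤ I.dist x y + I.dist y z := by
  obtain rfl | hxz := eq_or_ne x z
  · simp [dist_self]
  obtain rfl | hxy := eq_or_ne x y
  · simp [dist_self]
  obtain rfl | hyz := eq_or_ne y z
  · simp [dist_self]
  rw [dist_of_ne hxz, dist_of_ne hxy, dist_of_ne hyz]
  exact delay_triangle _ _ _

theorem arcCost_dist_le_sum_offset (π : Equiv.Perm I.Node) :
    arcCost I.dist π ≤ ∑ x : I.Node, I.offset x I.m :=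
  Finset.sum_le_sum fun x _ => dist_le_offset x (π x)

/-! ### Tours are lower bounds for the makespan -/

/-- The nodes in the order `τ` of the jobs, followed by the dummy job. -/
def nodeOrder (τ : Equiv.Perm (Fin I.n)) : Equiv.Perm I.Node :=
  (finSuccEquivLast.trans (Equiv.optionCongr τ)).trans finSuccEquivLast.symm

theorem nodeOrder_castSucc (τ : Equiv.Perm (Fin I.n)) (k : Fin I.n) :
    nodeOrder τ k.castSucc = (τ k).castSucc := by
  simp [nodeOrder]

theorem nodeOrder_last (τ : Equiv.Perm (Fin I.n)) : nodeOrder τ (Fin.last _) = Fin.last _ := by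
  simp [nodeOrder]

/-- The closed tour that visits the jobs in the order `τ` and then the dummy job. -/
def tour (τ : Equiv.Perm (Fin I.n)) : Equiv.Perm I.Node :=
  nodeOrder τ * finRotate (I.n + 1) * (nodeOrder τ)⁻¹

theorem tour_nodeOrder (τ : Equiv.Perm (Fin I.n)) (k : I.Node) :
    tour τ (nodeOrder τ k) = nodeOrder τ (k + 1) := by
  simp [tour]

theorem isTourAlong_tour (τ : Equiv.Perm (Fin I.n)) :
    IsTourAlong (nodeOrder τ).symm (Fin.last _) Finset.univ (tour τ) where
  apply_of_notMem x hx := absurd (Finset.mem_univ x) hx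
  lt_or_eq_root x _ hx := by
    obtain ⟨y, rfl⟩ := (nodeOrder τ).surjective x
    obtain ⟨k, rfl⟩ | rfl := Fin.eq_castSucc_or_eq_last y
    · left
      rw [tour_nodeOrder, Equiv.symm_apply_apply, Equiv.symm_apply_apply, Fin.coeSucc_eq_succ]
      exact Fin.castSucc_lt_succ
    · exact absurd (nodeOrder_last τ) hx

section LowerBounds

variable {α : Type*} [Preorder α] {pos : I.Node → α} {ρ : Equiv.Perm I.Node}

theorem sum_time_le_arcCost (hρ : IsTourAlong pos (Fin.last _) Finset.univ ρ) {i : ℕ}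
    (hi : i < I.m) : ∑ x : I.Node, I.time x i ≤ arcCost I.dist ρ := by
  have hstep : ∀ x : I.Node, I.offset x (i + 1) ≤ I.offset (ρ x) i + I.dist x (ρ x) := by
    intro x
    obtain rfl | hx := eq_or_ne x (Fin.last _)
    · rw [offset_last]
      exact Nat.zero_le _
    · rw [dist_of_ne (hρ.apply_ne (Finset.mem_univ x) hx).symm]
      exact offset_succ_le_add_delay _ _ hi
  have hsum := Finset.sum_le_sum fun x (_ : x ∈ Finset.univ) => hstep x
  simp only [offset_succ, Finset.sum_add_distrib] at hsum
  rw [Equiv.sum_comp ρ fun y => I.offset y i] at hsum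
  exact Nat.le_of_add_le_add_left hsum

theorem sum_offset_le (hρ : IsTourAlong pos (Fin.last _) Finset.univ ρ) :
    ∑ x : I.Node, I.offset x I.m ≤ I.m * arcCost I.dist ρ :=
  calc ∑ x : I.Node, I.offset x I.m = ∑ i ∈ Finset.range I.m, ∑ x : I.Node, I.time x i :=
        Finset.sum_comm
    _ ≤ (Finset.range I.m).card • arcCost I.dist ρ := Finset.sum_le_card_nsmul _ _ _ fun _ hi =>
        sum_time_le_arcCost hρ (Finset.mem_range.1 hi)
    _ = I.m * arcCost I.dist ρ := by simp

/-- Shortcutting the tour to `x` and the dummy job leaves the arc from `x` to the dummy job. -/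
theorem offset_le_arcCost (hρ : IsTourAlong pos (Fin.last _) Finset.univ ρ) (x : I.Node) :
    I.offset x I.m ≤ arcCost I.dist ρ := by
  obtain rfl | hx := eq_or_ne x (Fin.last _)
  · rw [offset_last]
    exact Nat.zero_le _
  obtain ⟨g, hg, hcost⟩ := hρ.exists_sdiff dist_self dist_triangle {x, Fin.last _}ᶜ (by simp)
  have hxmem : x ∈ Finset.univ \ {x, Fin.last _}ᶜ := by simp
  have hgx : g x = Fin.last _ := by
    have hmem := perm_apply_mem hg.apply_of_notMem hxmem
    simp only [Finset.mem_sdiff, Finset.mem_univ, true_and, Finset.mem_compl, not_not,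
      Finset.mem_insert, Finset.mem_singleton] at hmem
    exact hmem.resolve_left (hg.apply_ne hxmem hx)
  calc I.offset x I.m = I.dist x (g x) := by rw [hgx, dist_last_right]
    _ ≤ arcCost I.dist g :=
        Finset.single_le_sum (f := fun x => I.dist x (g x)) (fun _ _ => Nat.zero_le _)
          (Finset.mem_univ x)
    _ ≤ arcCost I.dist ρ := hcost

end LowerBounds

theorem completion_le_makespan (S : I.Schedule) (j : Fin I.n) (i : Fin I.m) :
    S j i + (I.t j i : ℝ≥0) ≤ I.makespan S :=
  (Finset.le_sup (f := fun i => S j i + (I.t j i : ℝ≥0)) (Finset.mem_univ i)).trans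
    (Finset.le_sup (f := fun j => Finset.univ.sup fun i => S j i + (I.t j i : ℝ≥0))
      (Finset.mem_univ j))

/-- The time at which the first operation of a job starts in the schedule `S`; the dummy job
starts at the makespan. -/
noncomputable def start (S : I.Schedule) (x : I.Node) : ℝ≥0 :=
  Fin.lastCases (motive := fun _ => ℝ≥0) (I.makespan S) (fun j => S j ⟨0, I.m_pos⟩) x

theorem start_castSucc (S : I.Schedule) (j : Fin I.n) : start S j.castSucc = S j ⟨0, I.m_pos⟩ :=
  Fin.lastCases_castSucc ..

theorem start_last (S : I.Schedule) : start S (Fin.last _) = I.makespan S := Fin.lastCases_last ..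

theorem add_sum_le_of_add_le_succ {M : Type*} [AddCommMonoid M] [PartialOrder M]
    [IsOrderedCancelAddMonoid M] {n : ℕ} {d : Fin n → M} {b : Fin (n + 1) → M}
    (h : ∀ k, b k.castSucc + d k ≤ b k.succ) : b 0 + ∑ k, d k ≤ b (Fin.last n) := by
  have hsum := Finset.sum_le_sum fun k (_ : k ∈ Finset.univ) => h k
  rw [Finset.sum_add_distrib] at hsum
  refine le_of_add_le_add_left (a := ∑ k : Fin n, b k.castSucc) ?_
  calc ∑ k : Fin n, b k.castSucc + (b 0 + ∑ k, d k)
      = b 0 + (∑ k : Fin n, b k.castSucc + ∑ k, d k) := add_left_comm _ _ _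
    _ ≤ b 0 + ∑ k : Fin n, b k.succ := by gcongr
    _ = ∑ k : Fin n, b k.castSucc + b (Fin.last n) := by
        rw [← Fin.sum_univ_succ, Fin.sum_univ_castSucc]

namespace IsFeasible

variable {τ : Equiv.Perm (Fin I.n)} {S : I.Schedule}

theorem eq_start_add_offset (h : I.IsFeasible τ S) (j : Fin I.n) (i : Fin I.m) :
    S j i = start S j.castSucc + (I.offset j i : ℝ≥0) := by
  obtain ⟨i, hi⟩ := i
  rw [start_castSucc]
  induction i with
  | zero => simp [offset]
  | succ i ih =>
    have hi' : i < I.m := Nat.lt_of_succ_lt hi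
    rw [h.no_wait j ⟨i, hi'⟩ ⟨i + 1, hi⟩ rfl, ih hi', ← time_fin, add_assoc, ← Nat.cast_add,
      ← offset_succ]

theorem completion_eq (h : I.IsFeasible τ S) (j : Fin I.n) (i : Fin I.m) :
    S j i + (I.t j i : ℝ≥0) = start S j.castSucc + (I.offset j (i + 1) : ℝ≥0) := by
  rw [h.eq_start_add_offset, ← time_fin, add_assoc, ← Nat.cast_add, ← offset_succ]

theorem start_add_offset_le_makespan (h : I.IsFeasible τ S) (j : Fin I.n) :
    start S j.castSucc + (I.offset j I.m : ℝ≥0) ≤ I.makespan S := by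
  have hlast := h.completion_eq j ⟨I.m - 1, Nat.sub_one_lt_of_lt I.m_pos⟩
  rw [Nat.sub_add_cancel I.m_pos] at hlast
  exact hlast ▸ completion_le_makespan S j _

theorem start_add_delay_le (h : I.IsFeasible τ S) {k l : Fin I.n} (hkl : k < l) :
    start S (τ k).castSucc + (I.delay (τ k) (τ l) : ℝ≥0) ≤ start S (τ l).castSucc := by
  obtain ⟨i, hi, hdelay⟩ := Finset.exists_mem_eq_sup (Finset.range I.m)
    ⟨0, Finset.mem_range.2 I.m_pos⟩ fun i => I.offset (τ k) (i + 1) - I.offset (τ l) i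
  rw [delay, hdelay]
  have horder : start S (τ k).castSucc + (I.offset (τ k) (i + 1) : ℝ≥0) ≤
      start S (τ l).castSucc + (I.offset (τ l) i : ℝ≥0) := by
    have := h.order ⟨i, Finset.mem_range.1 hi⟩ k l hkl
    rwa [h.completion_eq, h.eq_start_add_offset] at this
  obtain hle | hle := le_total (I.offset (τ k) (i + 1)) (I.offset (τ l) i)
  · have hfirst := h.order ⟨0, I.m_pos⟩ k l hkl
    rw [Nat.sub_eq_zero_of_le hle, Nat.cast_zero, add_zero, start_castSucc, start_castSucc]
    exact le_self_add.trans hfirst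
  · refine le_of_add_le_add_right (a := (I.offset (τ l) i : ℝ≥0)) ?_
    rwa [add_assoc, ← Nat.cast_add, Nat.sub_add_cancel hle]

theorem start_add_dist_le (h : I.IsFeasible τ S) (k : Fin I.n) :
    start S (nodeOrder τ k.castSucc) +
      (I.dist (nodeOrder τ k.castSucc) (nodeOrder τ k.succ) : ℝ≥0) ≤
        start S (nodeOrder τ k.succ) := by
  obtain ⟨l, hl⟩ | hlast := Fin.eq_castSucc_or_eq_last k.succ
  · have hkl : k < l := by
      rw [← Fin.castSucc_lt_castSucc_iff, ← hl]
      exact Fin.castSucc_lt_succ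
    rw [hl, nodeOrder_castSucc, nodeOrder_castSucc]
    refine le_trans ?_ (h.start_add_delay_le hkl)
    gcongr
    exact dist_le_delay _ _
  · rw [hlast, nodeOrder_castSucc, nodeOrder_last, dist_last_right, start_last]
    exact h.start_add_offset_le_makespan (τ k)

theorem arcCost_tour_le_makespan (h : I.IsFeasible τ S) :
    ((arcCost I.dist (tour τ) : ℕ) : ℝ≥0) ≤ I.makespan S := by
  have hcost : arcCost I.dist (tour τ) =
      ∑ k : Fin I.n, I.dist (nodeOrder τ k.castSucc) (nodeOrder τ k.succ) := by
    rw [arcCost, ← Equiv.sum_comp (nodeOrder τ), Fin.sum_univ_castSucc, nodeOrder_last,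
      dist_last_left, add_zero]
    simp only [tour_nodeOrder, Fin.coeSucc_eq_succ]
  have htelescope := add_sum_le_of_add_le_succ (b := fun k => start S (nodeOrder τ k))
    h.start_add_dist_le
  rw [hcost, Nat.cast_sum, ← start_last, ← nodeOrder_last τ]
  exact le_add_self.trans htelescope

end IsFeasible

/-! ### From tours to schedules -/

variable (I) in
/-- The starting time of the job in position `k` if the jobs are processed as early as possible in
the order `p 0, p 1, …`. -/
def earliestStart (p : ℕ → I.Node) (k : ℕ) : ℕ :=
  ∑ l ∈ Finset.range k, I.delay (p l) (p (l + 1))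

theorem earliestStart_add_offset_le (p : ℕ → I.Node) {i : ℕ} (hi : i < I.m) {k l : ℕ}
    (hkl : k < l) : I.earliestStart p k + I.offset (p k) (i + 1) ≤
      I.earliestStart p l + I.offset (p l) i := by
  have hstep : ∀ k, I.earliestStart p k + I.offset (p k) (i + 1) ≤
      I.earliestStart p (k + 1) + I.offset (p (k + 1)) i := by
    intro k
    have hdelay := offset_succ_le_add_delay (p k) (p (k + 1)) hi
    rw [earliestStart, earliestStart, Finset.sum_range_succ]
    omega
  induction l, hkl using Nat.le_induction with
  | base => exact hstep k
  | succ l _ ih =>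
    exact (ih.trans (Nat.add_le_add_left (offset_mono _ i.le_succ) _)).trans (hstep l)

section Schedule

variable {σ : Equiv.Perm (Fin I.n)} {p : ℕ → I.Node}

variable (σ p) in
/-- The schedule in which the job `σ k = p k` starts at the time `earliestStart p k`. -/
def earliestSchedule : I.Schedule := fun j i =>
  ((I.earliestStart p (σ.symm j) + I.offset j i : ℕ) : ℝ≥0)

theorem earliestSchedule_add_time (hp : ∀ k : Fin I.n, p k = (σ k).castSucc) (k : Fin I.n)
    (i : Fin I.m) : earliestSchedule σ p (σ k) i + (I.t (σ k) i : ℝ≥0) =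
      ((I.earliestStart p k + I.offset (p k) (i + 1) : ℕ) : ℝ≥0) := by
  rw [earliestSchedule, Equiv.symm_apply_apply, ← Nat.cast_add, add_assoc, ← time_fin,
    ← offset_succ, hp, Fin.val_castSucc]

theorem isFeasible_earliestSchedule (hp : ∀ k : Fin I.n, p k = (σ k).castSucc) :
    I.IsFeasible σ (earliestSchedule σ p) where
  no_wait j i i' hi := by
    rw [earliestSchedule, earliestSchedule, ← Nat.cast_add, add_assoc, ← time_fin, ← offset_succ,
      hi]
  order i k l hkl := by
    rw [earliestSchedule_add_time hp, earliestSchedule, Equiv.symm_apply_apply]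
    have hle := earliestStart_add_offset_le p i.2 (Fin.lt_def.1 hkl)
    rw [hp l, Fin.val_castSucc] at hle
    exact_mod_cast hle

theorem makespan_earliestSchedule_le (hp : ∀ k : Fin I.n, p k = (σ k).castSucc)
    (hlast : p I.n = Fin.last _) :
    I.makespan (earliestSchedule σ p) ≤ (I.earliestStart p I.n : ℝ≥0) := by
  refine Finset.sup_le fun j _ => Finset.sup_le fun i _ => ?_
  obtain ⟨k, rfl⟩ := σ.surjective j
  rw [earliestSchedule_add_time hp]
  have hle := earliestStart_add_offset_le p i.2 k.2
  rw [hlast, offset_last, add_zero] at hle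
  exact_mod_cast hle

end Schedule

section CyclicTour

variable {ν : Equiv.Perm I.Node}

theorem pow_apply_last_eq_last_iff (hν : ν.IsCycleOn (Finset.univ : Finset I.Node)) {k : ℕ} :
    (ν ^ k) (Fin.last _) = Fin.last _ ↔ I.n + 1 ∣ k := by
  rw [hν.pow_apply_eq (Finset.mem_univ _), Finset.card_univ, Fintype.card_fin]

theorem exists_jobOrder (hν : ν.IsCycleOn (Finset.univ : Finset I.Node)) :
    ∃ σ : Equiv.Perm (Fin I.n), ∀ k : Fin I.n, (ν ^ (k + 1 : ℕ)) (Fin.last _) = (σ k).castSucc := by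
  have hne : ∀ k : Fin I.n, (ν ^ (k + 1 : ℕ)) (Fin.last _) ≠ Fin.last _ := fun k h =>
    Nat.not_dvd_of_pos_of_lt k.1.succ_pos (Nat.succ_lt_succ k.2)
      ((pow_apply_last_eq_last_iff hν).1 h)
  have hinj : Function.Injective fun k : Fin I.n =>
      ((ν ^ (k + 1 : ℕ)) (Fin.last _)).castPred (hne k) := by
    intro k l hkl
    have hmod := (hν.pow_apply_eq_pow_apply (Finset.mem_univ _)).1 (Fin.castPred_inj.1 hkl)
    rw [Finset.card_univ, Fintype.card_fin] at hmod
    have := hmod.eq_of_lt_of_lt (Nat.succ_lt_succ k.2) (Nat.succ_lt_succ l.2)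
    exact Fin.ext (Nat.succ_injective this)
  exact ⟨Equiv.ofBijective _ (Finite.injective_iff_bijective.1 hinj), fun k => by simp⟩

theorem arcCost_eq_sum_range {V M : Type*} [Fintype V] [AddCommMonoid M] {d : V → V → M}
    {ν : Equiv.Perm V} (hν : ν.IsCycleOn (Finset.univ : Finset V)) (a : V) :
    arcCost d ν = ∑ k ∈ Finset.range (Fintype.card V), d ((ν ^ k) a) ((ν ^ (k + 1)) a) := by
  symm
  refine Finset.sum_nbij (fun k => (ν ^ k) a) (fun _ _ => Finset.mem_univ _) ?_ ?_ ?_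
  · intro k hk l hl hkl
    exact ((hν.pow_apply_eq_pow_apply (Finset.mem_univ a)).1 hkl).eq_of_lt_of_lt
      (Finset.mem_range.1 hk) (Finset.mem_range.1 hl)
  · intro x _
    obtain ⟨k, hk, hx⟩ := hν.exists_pow_eq (Finset.mem_univ a) (Finset.mem_univ x)
    exact ⟨k, Finset.mem_coe.2 (Finset.mem_range.2 hk), hx⟩
  · intro k _
    rw [pow_succ', Equiv.Perm.mul_apply]

theorem earliestStart_le_arcCost (hν : ν.IsCycleOn (Finset.univ : Finset I.Node)) :
    I.earliestStart (fun k => (ν ^ (k + 1)) (Fin.last _)) I.n ≤ arcCost I.dist ν := by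
  rw [arcCost_eq_sum_range hν (Fin.last _), Fintype.card_fin, Finset.sum_range_succ']
  refine le_add_right (Finset.sum_le_sum fun k hk => ?_)
  have hmod : ¬ k + 1 ≡ k + 1 + 1 [MOD I.n + 1] := fun h => by
    have hn := Finset.mem_range.1 hk
    have := (Nat.modEq_iff_dvd' (Nat.le_succ _)).1 h
    rw [Nat.succ_sub (le_refl _), Nat.sub_self, Nat.dvd_one] at this
    omega
  have hne : (ν ^ (k + 1)) (Fin.last I.n) ≠ (ν ^ (k + 1 + 1)) (Fin.last I.n) := fun h =>
    hmod (by simpa using (hν.pow_apply_eq_pow_apply (Finset.mem_univ _)).1 h)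
  exact (dist_of_ne hne).ge

theorem exists_isFeasible_of_isCycleOn (hν : ν.IsCycleOn (Finset.univ : Finset I.Node)) :
    ∃ σ : Equiv.Perm (Fin I.n),
      (∀ k : Fin I.n, (ν ^ (k + 1 : ℕ)) (Fin.last _) = (σ k).castSucc) ∧
      ∃ S : I.Schedule, I.IsFeasible σ S ∧ I.makespan S ≤ ((arcCost I.dist ν : ℕ) : ℝ≥0) := by
  obtain ⟨σ, hσ⟩ := exists_jobOrder hν
  refine ⟨σ, hσ, earliestSchedule σ fun k => (ν ^ (k + 1)) (Fin.last _),
    isFeasible_earliestSchedule hσ, (makespan_earliestSchedule_le hσ ?_).trans ?_⟩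
  · exact (pow_apply_last_eq_last_iff hν).2 dvd_rfl
  · exact_mod_cast earliestStart_le_arcCost hν

end CyclicTour

end NoWaitFlowshop

/-! ### Halving the cycles and joining the rest -/

namespace NoWaitFlowshop

variable (I : NoWaitFlowshop)

/-- The active nodes, given by their flags in the memory. -/
def activeSet (act : ℕ → ℕ) : Finset I.Node := Finset.univ.filter fun x => act x ≠ 0

/-- The price increment of the auctions; it exceeds all distances. -/
def increment : ℕ := (Finset.range (I.n + 1)).sup (fun j => I.offset j I.m) + 1

/-- The cost of a forbidden arc in the assignment problems. -/
def forbiddenCost : ℕ := 2 * ((I.n + 1) * (I.n + 1)) * I.increment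

/-- The costs of the assignment problem whose solutions are the covers of the active nodes by
cycles. Allowed arcs are scaled by `n + 1`, the number of persons that can each lose one increment
in an auction. -/
def coverCost (act : ℕ → ℕ) (i j : ℕ) : ℕ :=
  if i = j then if act i = 0 ∨ i = I.n then 0 else I.forbiddenCost
  else if act i ≠ 0 ∧ act j ≠ 0 then (I.n + 1) * I.delay i j
  else I.forbiddenCost

/-- The permutation `π` covers `A` by cycles, of which only `{Fin.last n}` may be trivial. -/
structure IsCycleCover (A : Finset I.Node) (π : Equiv.Perm I.Node) : Prop where
  apply_of_notMem : ∀ x ∉ A, π x = x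
  apply_ne : ∀ x ∈ A, x ≠ Fin.last _ → π x ≠ x

variable {I}

theorem mem_activeSet {act : ℕ → ℕ} {x : I.Node} : x ∈ I.activeSet act ↔ act x ≠ 0 := by
  simp [activeSet]

theorem offset_lt_increment (x : I.Node) : I.offset x I.m < I.increment :=
  Nat.lt_succ_of_le
    (Finset.le_sup (f := fun j => I.offset j I.m) (Finset.mem_range.2 x.2))

theorem increment_le {T : ℕ} (h : ∀ x : I.Node, I.offset x I.m ≤ T) : I.increment ≤ T + 1 :=
  Nat.succ_le_succ (Finset.sup_le fun j hj => h ⟨j, Finset.mem_range.1 hj⟩)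

theorem coverCost_le (act : ℕ → ℕ) {i : ℕ} (hi : i < I.n + 1) (j : ℕ) :
    I.coverCost act i j ≤ I.forbiddenCost := by
  rw [coverCost]
  split_ifs
  · exact Nat.zero_le _
  · exact le_rfl
  · calc (I.n + 1) * I.delay i j ≤ (I.n + 1) * I.increment :=
          Nat.mul_le_mul_left _ ((delay_le_offset i j).trans (offset_lt_increment ⟨i, hi⟩).le)
      _ ≤ I.forbiddenCost := Nat.mul_le_mul_right _ (by nlinarith)
  · exact le_rfl

theorem arcCost_dist_add_le (π : Equiv.Perm I.Node) :
    arcCost I.dist π + (I.n + 1) ≤ (I.n + 1) * I.increment := by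
  have hsum : ∑ x : I.Node, (I.dist x (π x) + 1) ≤ ∑ _x : I.Node, I.increment :=
    Finset.sum_le_sum fun x _ => (dist_le_offset x _).trans_lt (offset_lt_increment x)
  rw [Finset.sum_add_distrib] at hsum
  simpa [arcCost] using hsum

theorem IsTourAlong.isCycleCover {α : Type*} [Preorder α] {pos : I.Node → α} {A : Finset I.Node}
    {π : Equiv.Perm I.Node} (h : IsTourAlong pos (Fin.last _) A π) : I.IsCycleCover A π :=
  ⟨h.apply_of_notMem, fun _ => h.apply_ne⟩

theorem exists_isCycleCover {α : Type*} [Preorder α] {pos : I.Node → α} {ρ : Equiv.Perm I.Node}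
    (hρ : IsTourAlong pos (Fin.last _) Finset.univ ρ) {A : Finset I.Node} (hA : Fin.last _ ∈ A) :
    ∃ τ, I.IsCycleCover A τ ∧ arcCost I.dist τ ≤ arcCost I.dist ρ := by
  obtain ⟨τ, hτ, hcost⟩ := hρ.exists_sdiff dist_self dist_triangle Aᶜ (by simpa using hA)
  rw [← Finset.compl_eq_univ_sdiff, compl_compl] at hτ
  exact ⟨τ, IsTourAlong.isCycleCover hτ, hcost⟩

section AlmostOptimal

variable {act : ℕ → ℕ} {π : Equiv.Perm I.Node}

theorem IsCycleCover.coverCost_eq (hπ : I.IsCycleCover (I.activeSet act) π) (x : I.Node) :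
    I.coverCost act x (π x) = (I.n + 1) * I.dist x (π x) := by
  rw [coverCost]
  by_cases hx : π x = x
  · have hallowed : act x = 0 ∨ (x : ℕ) = I.n := by
      by_contra! h
      exact hπ.apply_ne x (mem_activeSet.2 h.1) (fun hlast => h.2 (congrArg Fin.val hlast)) hx
    rw [hx, if_pos rfl, if_pos hallowed, dist_self, mul_zero]
  · have hmem : x ∈ I.activeSet act := by
      by_contra h
      exact hx (hπ.apply_of_notMem x h)
    rw [if_neg fun h => hx (Fin.ext h.symm),
      if_pos ⟨mem_activeSet.1 hmem, mem_activeSet.1 (perm_apply_mem hπ.apply_of_notMem hmem)⟩,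
      dist_of_ne (Ne.symm hx)]

theorem IsCycleCover.arcCost_coverCost (hπ : I.IsCycleCover (I.activeSet act) π) :
    arcCost (fun x y : I.Node => I.coverCost act x y) π = (I.n + 1) * arcCost I.dist π := by
  simp only [arcCost, hπ.coverCost_eq, Finset.mul_sum]

theorem isCycleCover_of_coverCost_lt (h : ∀ x : I.Node, I.coverCost act x (π x) < I.forbiddenCost) :
    I.IsCycleCover (I.activeSet act) π where
  apply_of_notMem x hx := by
    by_contra hne
    have hlt := h x
    rw [mem_activeSet, not_not] at hx
    rw [coverCost, if_neg fun heq => hne (Fin.ext heq).symm, if_neg fun hact => hact.1 hx] at hlt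
    exact lt_irrefl _ hlt
  apply_ne x hx hlast heq := by
    have hlt := h x
    rw [heq, coverCost, if_pos rfl, if_neg] at hlt
    · exact lt_irrefl _ hlt
    · rintro (hact | hn)
      exacts [mem_activeSet.1 hx hact, hlast (Fin.ext hn)]

theorem coverCost_lt_of_arcCost_le {τ : Equiv.Perm I.Node}
    (h : arcCost (fun x y : I.Node => I.coverCost act x y) π ≤
      (I.n + 1) * arcCost I.dist τ + (I.n + 1) * I.increment) (x : I.Node) :
    I.coverCost act x (π x) < I.forbiddenCost := by
  have hx : I.coverCost act x (π x) ≤ arcCost (fun x y : I.Node => I.coverCost act x y) π :=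
    Finset.single_le_sum (f := fun x : I.Node => I.coverCost act x (π x))
      (fun _ _ => Nat.zero_le _) (Finset.mem_univ x)
  refine (hx.trans h).trans_lt ?_
  calc (I.n + 1) * arcCost I.dist τ + (I.n + 1) * I.increment
      < (I.n + 1) * (arcCost I.dist τ + (I.n + 1)) + (I.n + 1) * I.increment := by
        gcongr
        exact Nat.lt_add_of_pos_right I.n.succ_pos
    _ ≤ (I.n + 1) * ((I.n + 1) * I.increment) + (I.n + 1) * ((I.n + 1) * I.increment) := by
        gcongr
        · exact arcCost_dist_add_le τ
        · exact Nat.le_mul_of_pos_left _ I.n.succ_pos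
    _ = I.forbiddenCost := by
        rw [forbiddenCost]
        ring

/-- All arcs of `π` are allowed because a forbidden arc alone would be too expensive. -/
theorem isCycleCover_and_arcCost_le {α : Type*} [Preorder α] {pos : I.Node → α}
    {ρ : Equiv.Perm I.Node} (hρ : IsTourAlong pos (Fin.last _) Finset.univ ρ)
    (hlast : Fin.last _ ∈ I.activeSet act)
    (hπ : ∀ τ : Equiv.Perm I.Node, arcCost (fun x y : I.Node => I.coverCost act x y) π ≤
      arcCost (fun x y : I.Node => I.coverCost act x y) τ + (I.n + 1) * I.increment) :
    I.IsCycleCover (I.activeSet act) π ∧ arcCost I.dist π ≤ 3 * arcCost I.dist ρ := by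
  obtain ⟨τ, hτ, hτρ⟩ := exists_isCycleCover hρ hlast
  have hopt := hπ τ
  rw [hτ.arcCost_coverCost] at hopt
  have hcover := isCycleCover_of_coverCost_lt (coverCost_lt_of_arcCost_le hopt)
  refine ⟨hcover, ?_⟩
  rw [hcover.arcCost_coverCost, ← mul_add] at hopt
  have hπτ := Nat.le_of_mul_le_mul_left hopt I.n.succ_pos
  have hincr := increment_le (offset_le_arcCost hρ)
  obtain hzero | hpos := Nat.eq_zero_or_pos (arcCost I.dist ρ)
  · have hoffset : ∑ x : I.Node, I.offset x I.m = 0 :=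
      Nat.le_zero.1 ((sum_offset_le hρ).trans_eq (by rw [hzero, mul_zero]))
    have := arcCost_dist_le_sum_offset π
    omega
  · omega

end AlmostOptimal

variable (I) in
/-- Orders the nodes by total processing time; ties are broken in favour of the later node, so that
the dummy job comes first. -/
def key (j : ℕ) : ℕ := I.offset j I.m * (I.n + 1) + (I.n - j)

theorem key_div (j : ℕ) : I.key j / (I.n + 1) = I.offset j I.m := by
  rw [key, mul_comm, Nat.mul_add_div I.n.succ_pos, Nat.div_eq_of_lt (by omega), add_zero]

theorem key_mod (j : ℕ) : I.key j % (I.n + 1) = I.n - j := by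
  rw [key, Nat.mul_add_mod_self_right, Nat.mod_eq_of_lt (by omega)]

theorem key_injective : Function.Injective fun x : I.Node => I.key x := by
  intro x y hxy
  have hmod := congrArg (· % (I.n + 1)) hxy
  simp only [key_mod] at hmod
  exact Fin.ext (by omega)

theorem offset_le_of_key_le {j k : ℕ} (h : I.key j ≤ I.key k) : I.offset j I.m ≤ I.offset k I.m :=
  key_div (I := I) j ▸ key_div (I := I) k ▸ Nat.div_le_div_right h

theorem key_last : I.key (Fin.last I.n) = 0 := by simp [key, offset_of_le]

/-- The nodes of `A` with the least key in their cycles of `π`. -/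
def leaders (A : Finset I.Node) (π : Equiv.Perm I.Node) : Finset I.Node :=
  A.filter fun x => ∀ y, π.SameCycle x y → I.key x ≤ I.key y

section Leaders

variable {A : Finset I.Node} {π : Equiv.Perm I.Node}

theorem last_mem_leaders (h : Fin.last _ ∈ A) : Fin.last _ ∈ leaders A π :=
  Finset.mem_filter.2 ⟨h, fun _ _ => key_last (I := I) ▸ Nat.zero_le _⟩

theorem IsCycleCover.isCycleTransversal_leaders (hπ : I.IsCycleCover A π) :
    IsCycleTransversal π A (leaders A π) :=
  isCycleTransversal_filter_le key_injective hπ.apply_of_notMem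

/-- The successor of a leader other than the dummy job is not shorter and is not a leader. -/
theorem IsCycleCover.two_mul_sum_leaders_le (hπ : I.IsCycleCover A π) :
    2 * ∑ x ∈ leaders A π, I.offset x I.m ≤ ∑ x ∈ A, I.offset x I.m := by
  have htrans := hπ.isCycleTransversal_leaders
  have hsame : ∀ x, π.SameCycle x (π x) := fun x => ⟨1, by simp⟩
  have hsucc : ∀ x ∈ (leaders A π).erase (Fin.last _), π x ∈ A \ leaders A π := by
    intro x hx
    obtain ⟨hlast, hx⟩ := Finset.mem_erase.1 hx
    refine Finset.mem_sdiff.2 ⟨perm_apply_mem hπ.apply_of_notMem (htrans.subset hx), fun h => ?_⟩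
    exact hπ.apply_ne x (htrans.subset hx) hlast (htrans.eq_of_sameCycle x hx _ h (hsame x)).symm
  have hle : ∑ x ∈ leaders A π, I.offset x I.m ≤ ∑ x ∈ A \ leaders A π, I.offset x I.m :=
    calc ∑ x ∈ leaders A π, I.offset x I.m
        = ∑ x ∈ (leaders A π).erase (Fin.last _), I.offset x I.m :=
          (Finset.sum_erase (f := fun x : I.Node => I.offset x I.m) _ (offset_last I.m)).symm
      _ ≤ ∑ x ∈ (leaders A π).erase (Fin.last _), I.offset (π x) I.m :=
          Finset.sum_le_sum fun x hx => offset_le_of_key_le <|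
            (Finset.mem_filter.1 (Finset.mem_of_mem_erase hx)).2 _ (hsame x)
      _ = ∑ y ∈ ((leaders A π).erase (Fin.last _)).map π.toEmbedding, I.offset y I.m := by
          rw [Finset.sum_map]
          rfl
      _ ≤ ∑ x ∈ A \ leaders A π, I.offset x I.m :=
          Finset.sum_le_sum_of_subset fun y hy => by
            obtain ⟨x, hx, rfl⟩ := Finset.mem_map.1 hy
            exact hsucc x hx
  have hsplit := Finset.sum_sdiff (f := fun x : I.Node => I.offset x I.m) htrans.subset
  omega

end Leaders

/-- The state after `r` rounds for an instance with a tour of length `T`: every cycle of `ν`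
contains exactly one node of `A`. -/
structure RoundInv (I : NoWaitFlowshop) (T r : ℕ) (ν : Equiv.Perm I.Node) (A : Finset I.Node) :
    Prop where
  last_mem : Fin.last _ ∈ A
  transversal : IsCycleTransversal ν Finset.univ A
  cost : arcCost I.dist ν ≤ r * (3 * T)
  sum_offset : 2 ^ r * ∑ x ∈ A, I.offset x I.m ≤ ∑ x : I.Node, I.offset x I.m

/-- The state when only nodes from `k` on are still active and the cycles of the active nodes are
joined with the cycle of the dummy job. -/
structure JoinInv (I : NoWaitFlowshop) (b k : ℕ) (ν : Equiv.Perm I.Node) (A : Finset I.Node) :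
    Prop where
  last_mem : Fin.last _ ∈ A
  transversal : IsCycleTransversal ν Finset.univ A
  cost : arcCost I.dist ν + ∑ x ∈ A, I.offset x I.m ≤ b
  le_of_mem : ∀ x ∈ A, k ≤ (x : ℕ)

theorem RoundInv.initial (T : ℕ) : I.RoundInv T 0 1 Finset.univ where
  last_mem := Finset.mem_univ _
  transversal := isCycleTransversal_one _
  cost := by rw [arcCost_one dist_self, zero_mul]
  sum_offset := by rw [pow_zero, one_mul]

theorem RoundInv.mul {T r : ℕ} {ν π : Equiv.Perm I.Node} {A : Finset I.Node}
    (h : I.RoundInv T r ν A) (hπ : I.IsCycleCover A π) (hcost : arcCost I.dist π ≤ 3 * T) :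
    I.RoundInv T (r + 1) (π * ν) (leaders A π) where
  last_mem := last_mem_leaders h.last_mem
  transversal := h.transversal.mul hπ.apply_of_notMem hπ.isCycleTransversal_leaders
  cost := by
    rw [Nat.succ_mul, add_comm (r * _)]
    exact (arcCost_mul_le dist_triangle π ν).trans (Nat.add_le_add hcost h.cost)
  sum_offset := by
    rw [pow_succ, mul_assoc]
    exact (Nat.mul_le_mul_left _ hπ.two_mul_sum_leaders_le).trans h.sum_offset

theorem RoundInv.joinInv {α : Type*} [Preorder α] {pos : I.Node → α} {ρ : Equiv.Perm I.Node}
    (hρ : IsTourAlong pos (Fin.last _) Finset.univ ρ) {r : ℕ} {ν : Equiv.Perm I.Node}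
    {A : Finset I.Node} (h : I.RoundInv (arcCost I.dist ρ) r ν A) (hr : I.m ≤ 2 ^ r) :
    I.JoinInv ((3 * r + 1) * arcCost I.dist ρ) 0 ν A where
  last_mem := h.last_mem
  transversal := h.transversal
  cost := by
    have hsum : ∑ x ∈ A, I.offset x I.m ≤ arcCost I.dist ρ :=
      Nat.le_of_mul_le_mul_left
        (((Nat.mul_le_mul_right _ hr).trans h.sum_offset).trans (sum_offset_le hρ)) I.m_pos
    calc arcCost I.dist ν + ∑ x ∈ A, I.offset x I.m
        ≤ r * (3 * arcCost I.dist ρ) + arcCost I.dist ρ := Nat.add_le_add h.cost hsum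
      _ = (3 * r + 1) * arcCost I.dist ρ := by ring
  le_of_mem x _ := Nat.zero_le x

namespace JoinInv

variable {b : ℕ} {ν : Equiv.Perm I.Node} {A : Finset I.Node} {k : Fin I.n}

theorem succ_of_notMem (h : I.JoinInv b k ν A) (hk : k.castSucc ∉ A) :
    I.JoinInv b (k + 1) ν A where
  last_mem := h.last_mem
  transversal := h.transversal
  cost := h.cost
  le_of_mem x hx := (h.le_of_mem x hx).lt_of_ne fun heq => hk ((Fin.ext heq : k.castSucc = x) ▸ hx)

theorem succ_of_mem (h : I.JoinInv b k ν A) (hk : k.castSucc ∈ A) :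
    I.JoinInv b (k + 1) (swap k.castSucc (Fin.last _) * ν) (A.erase k.castSucc) where
  last_mem := Finset.mem_erase.2 ⟨(Fin.castSucc_ne_last k).symm, h.last_mem⟩
  transversal := by
    refine h.transversal.mul (fun x hx => Equiv.swap_apply_of_ne_of_ne ?_ ?_)
      (isCycleTransversal_swap hk h.last_mem (Fin.castSucc_ne_last k))
    exacts [fun heq => hx (heq ▸ hk), fun heq => hx (heq ▸ h.last_mem)]
  cost := by
    have hmul := arcCost_mul_le dist_triangle (swap k.castSucc (Fin.last _)) ν
    rw [arcCost_swap dist_self, dist_last_left, dist_last_right] at hmul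
    have hsum := Finset.add_sum_erase _ (fun x : I.Node => I.offset x I.m) hk
    have := h.cost
    omega
  le_of_mem x hx := by
    obtain ⟨hne, hx⟩ := Finset.mem_erase.1 hx
    exact (h.le_of_mem x hx).lt_of_ne fun heq => hne (Fin.ext heq.symm)

theorem isCycleOn (h : I.JoinInv b I.n ν A) : ν.IsCycleOn (Finset.univ : Finset I.Node) := by
  have hlast : ∀ x, ν.SameCycle (Fin.last _) x := by
    intro x
    obtain ⟨a, ha, hax⟩ := h.transversal.exists_sameCycle x (Finset.mem_univ x)
    rwa [(Fin.last_le_iff.1 (h.le_of_mem a ha) : a = Fin.last _)] at hax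
  rw [Finset.coe_univ]
  exact ⟨Set.bijOn_univ.2 ν.bijective, fun x _ y _ => (hlast x).symm.trans (hlast y)⟩

theorem cost_le (h : I.JoinInv b I.n ν A) : arcCost I.dist ν ≤ b :=
  (Nat.le_add_right _ _).trans h.cost

end JoinInv

end NoWaitFlowshop

/-! ### Programs on arrays -/

namespace RAM

@[simp]
theorem Memory.set_apply (s : Memory) (a i v a' i' : ℕ) :
    s.set a i v a' i' = if a' = a ∧ i' = i then v else s a' i' := by
  obtain rfl | ha := eq_or_ne a' a
  · simp [set_apply_same, Function.update_apply]
  · simp [set_of_ne _ ha, ha]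

theorem Memory.set_self (s : Memory) (a i : ℕ) : s.set a i (s a i) = s := by
  simp [Memory.set]

namespace Expr

instance : Add Expr := ⟨Expr.add⟩

instance : Sub Expr := ⟨Expr.sub⟩

instance : Mul Expr := ⟨Expr.mul⟩

@[simp]
theorem eval_add (s : Memory) (e f : Expr) : (e + f).eval s = e.eval s + f.eval s := rfl

@[simp]
theorem eval_sub (s : Memory) (e f : Expr) : (e - f).eval s = e.eval s - f.eval s := rfl

@[simp]
theorem eval_mul (s : Memory) (e f : Expr) : (e * f).eval s = e.eval s * f.eval s := rfl

@[simp]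
theorem eval_const (s : Memory) (c : ℕ) : (const c).eval s = c := rfl

@[simp]
theorem eval_read (s : Memory) (a : ℕ) (i : Expr) : (read a i).eval s = s a (i.eval s) := rfl

/-- The content of cell `0` of an array, used as a variable. -/
def cell (a : ℕ) : Expr := read a (const 0)

@[simp]
theorem eval_cell (s : Memory) (a : ℕ) : (cell a).eval s = s a 0 := rfl

/-- Nonzero if and only if the values of `e` and `f` differ, since subtraction is truncated. -/
def neq (e f : Expr) : Expr := (e - f) + (f - e)

@[simp]
theorem eval_neq_eq_zero {s : Memory} {e f : Expr} :
    (e.neq f).eval s = 0 ↔ e.eval s = f.eval s := by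
  rw [neq, eval_add, eval_sub, eval_sub]
  omega

end Expr

namespace Cmd

@[simp]
theorem run_seq (p q : Cmd) (s : Memory) : (seq p q).run s = q.run (p.run s) := rfl

@[simp]
theorem run_write (a : ℕ) (i e : Expr) (s : Memory) :
    (write a i e).run s = s.set a (i.eval s) (e.eval s) := rfl

theorem run_ite (e : Expr) (p q : Cmd) (s : Memory) :
    (ite e p q).run s = if e.eval s ≠ 0 then p.run s else q.run s := rfl

@[simp]
theorem run_skip (s : Memory) : skip.run s = s := rfl

/-- Assignment to a variable, that is, to cell `0` of an array. -/
def assign (a : ℕ) (e : Expr) : Cmd := write a (.const 0) e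

@[simp]
theorem run_assign (a : ℕ) (e : Expr) (s : Memory) :
    (assign a e).run s = s.set a 0 (e.eval s) := rfl

def assignIf (e : Expr) (a : ℕ) (f : Expr) : Cmd := ite e (assign a f) skip

@[simp]
theorem run_assignIf (e f : Expr) (a : ℕ) (s : Memory) :
    (assignIf e a f).run s = s.set a 0 (if e.eval s = 0 then s a 0 else f.eval s) := by
  by_cases h : e.eval s = 0 <;> simp [assignIf, run_ite, h, Memory.set_self]

def assignMax (a : ℕ) (e : Expr) : Cmd := assignIf (e - .cell a) a e

@[simp]
theorem run_assignMax (a : ℕ) (e : Expr) (s : Memory) :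
    (assignMax a e).run s = s.set a 0 (max (s a 0) (e.eval s)) := by
  rw [assignMax, run_assignIf, Expr.eval_sub, Expr.eval_cell]
  split_ifs
  · rw [max_eq_left (by omega)]
  · rw [max_eq_right (by omega)]

/-- In a counting loop, the value of `v` is stored in cell `t` of the array `a`, where `p` may
prepare the evaluation. -/
def fill (x a : ℕ) (e : Expr) (p : Cmd) (t v : Expr) : Cmd :=
  forLoop x e (seq p (write a t v))

theorem run_fill {x a : ℕ} {e : Expr} {p : Cmd} {t v : Expr} {s : Memory} (n : ℕ)
    (hn : e.eval s = n) (hxa : x ≠ a) (hap : a ∉ p.writes) {addr : ℕ → ℕ}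
    (haddr : Function.Injective addr) (F : ℕ → ℕ)
    (h : ∀ i < n, ∀ s', s' x 0 = i → (∀ b ∉ (fill x a e p t v).writes, s' b = s b) →
      s' a (addr i) = s a (addr i) → t.eval (p.run s') = addr i ∧ v.eval (p.run s') = F i) :
    (∀ i < n, (fill x a e p t v).run s a (addr i) = F i) ∧
      ∀ c, (∀ i < n, c ≠ addr i) → (fill x a e p t v).run s a c = s a c := by
  refine run_forLoop_induction (I := fun k s' => (∀ i < k, s' a (addr i) = F i) ∧
    ∀ c, (∀ i < k, c ≠ addr i) → s' a c = s a c) n hn ?_ (by simp) ?_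
  · intro k s' w hI
    simpa only [Memory.set_of_ne _ hxa.symm] using hI
  · rintro k hk s' hx hframe ⟨hdone, hrest⟩
    obtain ⟨ht, hv⟩ := h k hk s' hx hframe
      (hrest _ fun i hi heq => hi.ne' (haddr heq))
    have hset : (seq p (write a t v)).run s' a = Function.update (s' a) (addr k) (F k) := by
      rw [run_seq, run_write, ht, hv, Memory.set_apply_same, run_of_notMem_writes hap]
    rw [hset]
    refine ⟨fun i hi => ?_, fun c hc => ?_⟩
    · obtain rfl | hne := eq_or_ne i k
      · exact Function.update_self ..
      · rw [Function.update_of_ne (haddr.ne hne), hdone i (by omega)]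
    · rw [Function.update_of_ne (hc k k.lt_succ_self), hrest c fun i hi => hc i (by omega)]

/-- The cells of the array `a` are recomputed one by one. -/
def mapArray (x a : ℕ) (e : Expr) (p : Cmd) (v : Expr) : Cmd := fill x a e p (.cell x) v

theorem run_mapArray {x a : ℕ} {e : Expr} {p : Cmd} {v : Expr} {s : Memory} (n : ℕ)
    (hn : e.eval s = n) (hxa : x ≠ a) (hxp : x ∉ p.writes) (hap : a ∉ p.writes) (F : ℕ → ℕ)
    (h : ∀ i < n, ∀ s', s' x 0 = i → (∀ b ∉ (mapArray x a e p v).writes, s' b = s b) →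
      s' a i = s a i → v.eval (p.run s') = F i) :
    ∀ i < n, (mapArray x a e p v).run s a i = F i :=
  (run_fill n hn hxa hap Function.injective_id F fun i hi s' hx hframe ha =>
    ⟨by rw [Expr.eval_cell, run_of_notMem_writes hxp, hx, id], h i hi s' hx hframe ha⟩).1

theorem run_mapArray_fin {x a n : ℕ} {e : Expr} {p : Cmd} {v : Expr} {s : Memory}
    (hn : e.eval s = n) (hxa : x ≠ a) (hxp : x ∉ p.writes) (hap : a ∉ p.writes) (F : Fin n → ℕ)
    (h : ∀ i : Fin n, ∀ s', s' x 0 = (i : ℕ) → (∀ b ∉ (mapArray x a e p v).writes, s' b = s b) →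
      s' a i = s a i → v.eval (p.run s') = F i) (i : Fin n) :
    (mapArray x a e p v).run s a i = F i := by
  rw [run_mapArray n hn hxa hxp hap (fun i => if hi : i < n then F ⟨i, hi⟩ else 0) _ i i.2,
    dif_pos i.2]
  intro j hj s' hx hframe ha
  rw [dif_pos hj, h ⟨j, hj⟩ s' hx hframe ha]

/-- The entries of the matrix `a` with `e` rows and columns are computed one by one. -/
def fillMatrix (x y a : ℕ) (e : Expr) (p : Cmd) (v : Expr) : Cmd :=
  forLoop x e (fill y a e p (.cell x * e + .cell y) v)

theorem run_fillMatrix {x y a : ℕ} {e : Expr} {p : Cmd} {v : Expr} {s : Memory} (n : ℕ)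
    (hd : [x, y, a].Nodup) (hap : a ∉ p.writes) (hxp : x ∉ p.writes) (hyp : y ∉ p.writes)
    (he : ∀ s', (∀ b ∉ (fillMatrix x y a e p v).writes, s' b = s b) → e.eval s' = n)
    (F : ℕ → ℕ → ℕ)
    (h : ∀ i < n, ∀ j < n, ∀ s', s' x 0 = i → s' y 0 = j →
      (∀ b ∉ (fillMatrix x y a e p v).writes, s' b = s b) → v.eval (p.run s') = F i j) :
    ∀ i < n, ∀ j < n, (fillMatrix x y a e p v).run s a (i * n + j) = F i j := by
  simp only [List.nodup_cons, List.mem_cons, List.not_mem_nil, or_false, not_or] at hd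
  obtain ⟨⟨hxy, hxa⟩, hya, -⟩ := hd
  refine run_forLoop_induction (I := fun k s' => ∀ i < k, ∀ j < n, s' a (i * n + j) = F i j)
    n (he s fun _ _ => rfl) ?_ (by simp) ?_
  · intro k s' w hI
    simpa only [Memory.set_of_ne _ (Ne.symm hxa)] using hI
  intro i hi s₁ hx₁ hframe₁ hdone
  obtain ⟨hrow, hrest⟩ := run_fill (x := y) (a := a) (e := e) (p := p) (v := v) (s := s₁)
    (t := .cell x * e + .cell y) n (he s₁ hframe₁) hya hap (add_right_injective (i * n)) (F i) (by
    intro j hj s₂ hy₂ hframe₂ _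
    have hx₂ : s₂ x 0 = i := by
      rw [hframe₂ x (by simp [fill, writes, hxy, hxa, hxp]), hx₁]
    have hframe : ∀ b ∉ (fillMatrix x y a e p v).writes, s₂ b = s b := fun b hb => by
      rw [hframe₂ b fun hb' => hb (List.mem_cons_of_mem x hb'), hframe₁ b hb]
    have hframe' : ∀ b ∉ (fillMatrix x y a e p v).writes, p.run s₂ b = s b := fun b hb => by
      rw [run_of_notMem_writes (fun hb' => hb (by simp [fillMatrix, fill, writes, hb'])),
        hframe b hb]
    refine ⟨?_, h i hi j hj s₂ hx₂ hy₂ hframe⟩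
    rw [Expr.eval_add, Expr.eval_mul, Expr.eval_cell, Expr.eval_cell, he _ hframe',
      run_of_notMem_writes hxp, run_of_notMem_writes hyp, hx₂, hy₂])
  intro i' hi' j hj
  obtain hlt | rfl := Nat.lt_succ_iff_lt_or_eq.1 hi'
  · rw [hrest _ fun j' _ => ?_, hdone i' hlt j hj]
    have := Nat.mul_le_mul_right n (Nat.succ_le_of_lt hlt)
    rw [Nat.succ_mul] at this
    omega
  · exact hrow j hj

end Cmd

end RAM

/-! ### The program: delays and costs -/

namespace NoWaitFlowshop

open RAM RAM.Cmd RAM.Expr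

section Encoding

variable {I : NoWaitFlowshop}

theorem flatten_ofFn_ofFn_eq :
    (List.ofFn fun j => List.ofFn (I.t j)).flatten =
      List.ofFn (n := I.n * I.m) fun k => I.time (k / I.m) (k % I.m) := by
  rw [List.ofFn_mul]
  congr 2 with j : 1
  congr 1 with i : 1
  have hdiv : ((j : ℕ) * I.m + i) / I.m = j := by
    rw [mul_comm, Nat.mul_add_div I.m_pos, Nat.div_eq_of_lt i.2, add_zero]
  have hmod : ((j : ℕ) * I.m + i) % I.m = i := by
    rw [mul_comm, Nat.mul_add_mod, Nat.mod_eq_of_lt i.2]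
  simp only [hdiv, hmod, time_fin]

theorem encode_getD (j : ℕ) {i : ℕ} (hi : i < I.m) :
    I.encode.getD (2 + j * I.m + i) 0 = I.time j i := by
  have haddr : 2 + j * I.m + i = j * I.m + i + 1 + 1 := by omega
  rw [encode, haddr, List.getD_cons_succ, List.getD_cons_succ, flatten_ofFn_ofFn_eq,
    List.getD_eq_getElem?_getD, List.getElem?_ofFn]
  have hdiv : (j * I.m + i) / I.m = j := by
    rw [mul_comm, Nat.mul_add_div I.m_pos, Nat.div_eq_of_lt hi, add_zero]
  have hmod : (j * I.m + i) % I.m = i := by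
    rw [mul_comm, Nat.mul_add_mod, Nat.mod_eq_of_lt hi]
  split_ifs with h
  · simp only [Option.getD_some, hdiv, hmod]
  · rw [Option.getD_none, time_of_le]
    by_contra! hj
    have hle := Nat.mul_le_mul_right I.m (Nat.succ_le_of_lt hj)
    rw [Nat.succ_mul] at hle
    omega

end Encoding

/-! The arrays of the program; from `row` on, only cell `0` is used. -/

namespace Loc

@[simp] abbrev input : ℕ := 0
@[simp] abbrev output : ℕ := 1
@[simp] abbrev delays : ℕ := 2
@[simp] abbrev perm : ℕ := 3
@[simp] abbrev active : ℕ := 4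
@[simp] abbrev holding : ℕ := 5
@[simp] abbrev prices : ℕ := 6
@[simp] abbrev costs : ℕ := 7
@[simp] abbrev row : ℕ := 8
@[simp] abbrev col : ℕ := 9
@[simp] abbrev machine : ℕ := 10
@[simp] abbrev rowSum : ℕ := 11
@[simp] abbrev colSum : ℕ := 12
@[simp] abbrev acc : ℕ := 13
@[simp] abbrev step : ℕ := 14
@[simp] abbrev power : ℕ := 15
@[simp] abbrev node : ℕ := 16
@[simp] abbrev round : ℕ := 17
@[simp] abbrev sweep : ℕ := 18
@[simp] abbrev person : ℕ := 19
@[simp] abbrev object : ℕ := 20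

end Loc

def jobs : Expr := cell Loc.input

def nodes : Expr := jobs + const 1

def machines : Expr := read Loc.input (const 1)

@[simp]
theorem eval_jobs (s : Memory) : jobs.eval s = s Loc.input 0 := rfl

@[simp]
theorem eval_nodes (s : Memory) : nodes.eval s = s Loc.input 0 + 1 := rfl

@[simp]
theorem eval_machines (s : Memory) : machines.eval s = s Loc.input 1 := rfl

/-- The entry of a matrix indexed by pairs of nodes. -/
def entry (a : ℕ) (i j : Expr) : Expr := read a (i * nodes + j)

@[simp]
theorem eval_entry (s : Memory) (a : ℕ) (i j : Expr) :
    (entry a i j).eval s = s a (i.eval s * (s Loc.input 0 + 1) + j.eval s) := rfl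

/-- The processing time of a job on the current machine. -/
def timeOf (j : Expr) : Expr := read Loc.input (const 2 + j * machines + cell Loc.machine)

/-- The contribution of one machine to the delay between the jobs in `row` and `col`. -/
def delayStep : Cmd :=
  .seq (assign Loc.rowSum (cell Loc.rowSum + timeOf (cell Loc.row))) <|
  .seq (assignMax Loc.acc (cell Loc.rowSum - cell Loc.colSum)) <|
  assign Loc.colSum (cell Loc.colSum + timeOf (cell Loc.col))

def delayProg : Cmd :=
  .seq (assign Loc.rowSum (const 0)) <| .seq (assign Loc.colSum (const 0)) <|
  .seq (assign Loc.acc (const 0)) <| .forLoop Loc.machine machines delayStep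

def delaysProg : Cmd := fillMatrix Loc.row Loc.col Loc.delays nodes delayProg (cell Loc.acc)

/-- The total processing time of a job is its delay before the dummy job. -/
def incrementProg : Cmd :=
  .seq (assign Loc.step (const 0)) <|
  .seq (.forLoop Loc.row nodes (assignMax Loc.step (entry Loc.delays (cell Loc.row) jobs))) <|
  assign Loc.step (cell Loc.step + const 1)

def forbidden : Expr := const 2 * (nodes * nodes) * cell Loc.step

def coverCostEntry : Cmd :=
  .ite ((cell Loc.row).neq (cell Loc.col))
    (.ite (read Loc.active (cell Loc.row) * read Loc.active (cell Loc.col))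
      (assign Loc.acc (nodes * entry Loc.delays (cell Loc.row) (cell Loc.col)))
      (assign Loc.acc forbidden))
    (.ite (read Loc.active (cell Loc.row) * (jobs - cell Loc.row))
      (assign Loc.acc forbidden) (assign Loc.acc (const 0)))

def coverCostProg : Cmd :=
  fillMatrix Loc.row Loc.col Loc.costs nodes coverCostEntry (cell Loc.acc)

/-- The memory contains the instance `I`. -/
structure IsInput (I : NoWaitFlowshop) (s : Memory) : Prop where
  input_eq : s Loc.input = initMem I.encode Loc.input

/-- The memory contains the instance `I`, its delays and the price increment. -/
structure Prepared (I : NoWaitFlowshop) (s : Memory) : Prop extends IsInput I s where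
  delays : ∀ i < I.n + 1, ∀ j < I.n + 1, s Loc.delays (i * (I.n + 1) + j) = I.delay i j
  increment : s Loc.step 0 = I.increment

variable {I : NoWaitFlowshop} {s s' : Memory}

theorem IsInput.jobs (h : I.IsInput s) : s Loc.input 0 = I.n := by
  rw [h.input_eq]; rfl

theorem IsInput.machines (h : I.IsInput s) : s Loc.input 1 = I.m := by
  rw [h.input_eq]; rfl

theorem IsInput.eval_timeOf (h : I.IsInput s) {e : Expr} (hi : s Loc.machine 0 < I.m) :
    (timeOf e).eval s = I.time (e.eval s) (s Loc.machine 0) := by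
  simp only [timeOf, eval_read, eval_add, eval_mul, eval_const, eval_cell, eval_machines,
    h.machines]
  rw [← encode_getD _ hi, h.input_eq]
  rfl

theorem IsInput.congr (h : I.IsInput s) (hs : s' Loc.input = s Loc.input) : I.IsInput s' :=
  ⟨hs.trans h.input_eq⟩

theorem Prepared.congr (h : I.Prepared s)
    (hs : ∀ a ∈ [Loc.input, Loc.delays, Loc.step], s' a = s a) : I.Prepared s' where
  toIsInput := h.toIsInput.congr (hs _ (by decide))
  delays := by rw [hs _ (by decide)]; exact h.delays
  increment := by rw [hs _ (by decide)]; exact h.increment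

theorem run_delayStep (h : I.IsInput s) (hm : s Loc.machine 0 < I.m)
    (hrow : s Loc.rowSum 0 = I.offset (s Loc.row 0) (s Loc.machine 0))
    (hcol : s Loc.colSum 0 = I.offset (s Loc.col 0) (s Loc.machine 0)) :
    delayStep.run s Loc.rowSum 0 = I.offset (s Loc.row 0) (s Loc.machine 0 + 1) ∧
      delayStep.run s Loc.colSum 0 = I.offset (s Loc.col 0) (s Loc.machine 0 + 1) ∧
      delayStep.run s Loc.acc 0 = max (s Loc.acc 0)
        (I.offset (s Loc.row 0) (s Loc.machine 0 + 1) -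
          I.offset (s Loc.col 0) (s Loc.machine 0)) := by
  have htime : ∀ s' e, s' Loc.input = s Loc.input → s' Loc.machine = s Loc.machine →
      (timeOf e).eval s' = I.time (e.eval s') (s Loc.machine 0) := fun s' e hin hmach => by
    rw [(h.congr hin).eval_timeOf (by rwa [hmach]), hmach]
  simp [delayStep, htime, Memory.set_of_ne, hrow, hcol, offset_succ]

theorem run_delayProg (h : I.IsInput s) :
    delayProg.run s Loc.acc 0 = I.delay (s Loc.row 0) (s Loc.col 0) := by
  rw [delayProg, run_seq, run_seq, run_seq]
  refine (run_forLoop_induction (I := fun i s' =>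
    s' Loc.rowSum 0 = I.offset (s Loc.row 0) i ∧ s' Loc.colSum 0 = I.offset (s Loc.col 0) i ∧
      s' Loc.acc 0 = (Finset.range i).sup
        fun i => I.offset (s Loc.row 0) (i + 1) - I.offset (s Loc.col 0) i) I.m
    (by simpa using h.machines) ?_ ?_ ?_).2.2
  · intro k s' v hI
    simpa using hI
  · simp [offset]
  · rintro i hi s' hmach hframe ⟨hrowSum, hcolSum, hacc⟩
    have hrow : s' Loc.row = s Loc.row := by rw [hframe _ (by decide)]; simp [Memory.set_of_ne]
    have hcol : s' Loc.col = s Loc.col := by rw [hframe _ (by decide)]; simp [Memory.set_of_ne]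
    have hin : I.IsInput s' := h.congr (by rw [hframe _ (by decide)]; simp [Memory.set_of_ne])
    obtain ⟨hrowSum', hcolSum', hacc'⟩ := run_delayStep hin (by rwa [hmach])
      (by rw [hrowSum, hrow, hmach]) (by rw [hcolSum, hcol, hmach])
    rw [hrowSum', hcolSum', hacc', hacc, hrow, hcol, hmach, Finset.range_add_one,
      Finset.sup_insert, max_comm]
    exact ⟨rfl, rfl, rfl⟩

theorem run_delaysProg (h : I.IsInput s) : ∀ i < I.n + 1, ∀ j < I.n + 1,
    delaysProg.run s Loc.delays (i * (I.n + 1) + j) = I.delay i j := by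
  refine run_fillMatrix (I.n + 1) (by decide) (by decide) (by decide) (by decide)
    (fun s' hs' => ?_) _ fun i _ j _ s' hrow hcol hframe => ?_
  · rw [eval_nodes, hs' _ (by decide), h.jobs]
  · rw [eval_cell, run_delayProg (h.congr (hframe _ (by decide))), hrow, hcol]

theorem run_incrementProg (h : I.IsInput s)
    (hd : ∀ i < I.n + 1, ∀ j < I.n + 1, s Loc.delays (i * (I.n + 1) + j) = I.delay i j) :
    incrementProg.run s Loc.step 0 = I.increment := by
  have hmax := run_forLoop_induction (x := Loc.row) (e := nodes)
    (p := assignMax Loc.step (entry Loc.delays (cell Loc.row) jobs))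
    (s := (assign Loc.step (const 0)).run s)
    (fun k s' => s' Loc.step 0 = (Finset.range k).sup fun j => I.offset j I.m) (I.n + 1)
    (by simp [h.jobs]) (fun k s' v hI => by simpa using hI) (by simp) (by
      intro k hk s' hrow hframe hstep
      have hdelay : s' Loc.delays (k * (I.n + 1) + I.n) = I.offset k I.m := by
        rw [hframe _ (by decide), run_assign, Memory.set_of_ne _ (by decide),
          hd k hk _ I.n.lt_succ_self, delay_of_le_right _ le_rfl]
      have hjobs : s' Loc.input 0 = I.n := by
        rw [hframe _ (by decide), run_assign, Memory.set_of_ne _ (by decide), h.jobs]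
      rw [run_assignMax, Memory.set_apply, if_pos ⟨rfl, rfl⟩, eval_entry, eval_cell, eval_jobs,
        hrow, hjobs, hdelay, hstep, Finset.range_add_one, Finset.sup_insert, max_comm])
  simp only [incrementProg, run_seq, run_assign, Memory.set_apply, and_self, if_true, eval_add,
    eval_cell, eval_const, increment] at hmax ⊢
  rw [hmax]

theorem run_coverCostEntry (h : I.Prepared s) (hrow : s Loc.row 0 < I.n + 1)
    (hcol : s Loc.col 0 < I.n + 1) :
    coverCostEntry.run s Loc.acc 0 =
      I.coverCost (s Loc.active) (s Loc.row 0) (s Loc.col 0) := by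
  have hforbidden : forbidden.eval s = I.forbiddenCost := by
    simp [forbidden, forbiddenCost, h.jobs, h.increment]
  have hdelay := h.delays _ hrow _ hcol
  have hlast : I.n - s Loc.row 0 = 0 ↔ s Loc.row 0 = I.n := by omega
  rw [coverCostEntry, run_ite, run_ite, run_ite, coverCost]
  simp only [ne_eq, eval_neq_eq_zero, eval_cell, eval_mul, eval_read, eval_sub, eval_jobs, h.jobs,
    mul_eq_zero, hlast, run_assign, hforbidden, eval_nodes, eval_entry, hdelay, eval_const]
  split_ifs <;> first | rfl | simp_all

theorem run_coverCostProg (h : I.Prepared s) : ∀ i < I.n + 1, ∀ j < I.n + 1,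
    coverCostProg.run s Loc.costs (i * (I.n + 1) + j) = I.coverCost (s Loc.active) i j := by
  refine run_fillMatrix (I.n + 1) (by decide) (by decide) (by decide) (by decide)
    (fun s' hs' => ?_) _ fun i hi j hj s' hrow hcol hframe => ?_
  · rw [eval_nodes, hs' _ (by decide), h.jobs]
  · have hs' : I.Prepared s' := h.congr fun a ha => hframe a (by revert a; decide)
    rw [eval_cell, run_coverCostEntry hs' (by omega) (by omega), hrow, hcol,
      hframe _ (by decide)]

end NoWaitFlowshop

/-! ### The program: auction -/

namespace NoWaitFlowshop

open RAM RAM.Cmd RAM.Expr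

/-- The cost of an object for the current person, including its price. -/
def pricedCost (j : Expr) : Expr :=
  entry Loc.costs (cell Loc.person) j + read Loc.prices j * cell Loc.step

def bestObjectProg : Cmd :=
  .seq (assign Loc.object (const 0)) <|
  .forLoop Loc.col nodes
    (assignIf (pricedCost (cell Loc.object) - pricedCost (cell Loc.col)) Loc.object (cell Loc.col))

def releaseProg : Cmd :=
  mapArray Loc.row Loc.holding nodes
    (.ite ((read Loc.holding (cell Loc.row)).neq (cell Loc.object + const 1))
      (assign Loc.acc (read Loc.holding (cell Loc.row))) (assign Loc.acc (const 0)))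
    (cell Loc.acc)

def bidProg : Cmd :=
  .seq bestObjectProg <| .seq releaseProg <|
  .seq (.write Loc.holding (cell Loc.person) (cell Loc.object + const 1)) <|
  .write Loc.prices (cell Loc.object) (read Loc.prices (cell Loc.object) + const 1)

/-- Every person who holds nothing when their turn comes makes a bid. -/
def sweepProg : Cmd :=
  .forLoop Loc.person nodes (.ite (read Loc.holding (cell Loc.person)) .skip bidProg)

/-- The prices sum to at most `2 N³ + N` increments, where `N` is the number of nodes, and every
sweep raises a price unless all persons hold an object, so `4 N³` sweeps suffice. -/
def auctionProg : Cmd :=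
  .seq (mapArray Loc.row Loc.holding nodes .skip (const 0)) <|
  .seq (mapArray Loc.row Loc.prices nodes .skip (const 0)) <|
  .forLoop Loc.sweep (const 4 * (nodes * nodes * nodes)) sweepProg

/-- The memory contains the input of an auction with `N` persons, price increment `E` and cost
matrix `c`. -/
structure IsAuctionInput (N E : ℕ) (c : ℕ → ℕ → ℕ) (s : Memory) : Prop where
  nodes : s Loc.input 0 + 1 = N
  increment : s Loc.step 0 = E
  costs : ∀ i < N, ∀ j < N, s Loc.costs (i * N + j) = c i j

variable {N E : ℕ} {c : ℕ → ℕ → ℕ} {s s' : Memory}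

theorem IsAuctionInput.congr (h : IsAuctionInput N E c s)
    (hs : ∀ a ∈ [Loc.input, Loc.step, Loc.costs], s' a = s a) : IsAuctionInput N E c s' where
  nodes := by rw [hs _ (by decide)]; exact h.nodes
  increment := by rw [hs _ (by decide)]; exact h.increment
  costs := by rw [hs _ (by decide)]; exact h.costs

theorem IsAuctionInput.eval_pricedCost (h : IsAuctionInput N E c s) {e : Expr}
    (hi : s Loc.person 0 < N) (hj : e.eval s < N) :
    (pricedCost e).eval s =
      c (s Loc.person 0) (e.eval s) + s Loc.prices (e.eval s) * E := by
  rw [pricedCost, eval_add, eval_entry, eval_mul, eval_read, eval_cell, eval_cell, h.nodes,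
    h.costs _ hi _ hj, h.increment]

theorem run_bestObjectProg (h : IsAuctionInput N E c s) (hi : s Loc.person 0 < N) :
    bestObjectProg.run s Loc.object 0 < N ∧ ∀ j < N,
      c (s Loc.person 0) (bestObjectProg.run s Loc.object 0) +
          s Loc.prices (bestObjectProg.run s Loc.object 0) * E ≤
        c (s Loc.person 0) j + s Loc.prices j * E := by
  rw [bestObjectProg, run_seq, run_assign]
  refine run_forLoop_induction (I := fun k s' => s' Loc.object 0 < N ∧ ∀ j < k,
    c (s Loc.person 0) (s' Loc.object 0) + s Loc.prices (s' Loc.object 0) * E ≤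
      c (s Loc.person 0) j + s Loc.prices j * E) N
    (by simpa using h.nodes) ?_ ?_ ?_
  · intro k s' v hI
    simpa only [Memory.set_of_ne _ (show Loc.object ≠ Loc.col by decide)] using hI
  · have hN := h.nodes
    refine ⟨?_, by simp⟩
    rw [Memory.set_apply_same, eval_const, Function.update_self]
    omega
  rintro k hk s' hcol hframe ⟨hb, hmin⟩
  have heq : ∀ a ∈ [Loc.input, Loc.step, Loc.costs, Loc.person, Loc.prices], s' a = s a :=
    fun a ha => by rw [hframe a (by revert a; decide), Memory.set_of_ne _ (by revert a; decide)]
  have hs' : IsAuctionInput N E c s' := h.congr fun a ha => heq a (by revert a; decide)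
  have hperson : s' Loc.person = s Loc.person := heq _ (by decide)
  have hprices : s' Loc.prices = s Loc.prices := heq _ (by decide)
  rw [run_assignIf, Memory.set_apply_same, Function.update_self, eval_sub,
    hs'.eval_pricedCost (e := cell Loc.object) (by rwa [hperson]) hb,
    hs'.eval_pricedCost (by rwa [hperson]) (by rwa [eval_cell, hcol]), eval_cell, eval_cell, hcol,
    hperson, hprices]
  split_ifs with hle
  · refine ⟨hb, fun j hj => ?_⟩
    obtain hlt | rfl := Nat.lt_succ_iff_lt_or_eq.1 hj
    exacts [hmin j hlt, by omega]
  · refine ⟨hk, fun j hj => ?_⟩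
    obtain hlt | rfl := Nat.lt_succ_iff_lt_or_eq.1 hj
    exacts [(by omega : _ ≤ _).trans (hmin j hlt), le_rfl]

theorem run_releaseProg (hN : s Loc.input 0 + 1 = N) : ∀ i < N,
    releaseProg.run s Loc.holding i =
      if s Loc.holding i = s Loc.object 0 + 1 then 0 else s Loc.holding i := by
  refine run_mapArray N (by simpa using hN) (by decide) (by decide) (by decide) _
    fun i _ s' hrow hframe hhold => ?_
  have hobject : s' Loc.object = s Loc.object := hframe _ (by decide)
  rw [run_ite]
  simp only [ne_eq, eval_neq_eq_zero, eval_read, eval_add, eval_cell, eval_const, run_assign, hrow,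
    hobject, hhold]
  split_ifs <;> simp_all

theorem exists_isBid_run_bidProg (h : IsAuctionInput N E c s) (hi : s Loc.person 0 < N)
    (h0 : s Loc.holding (s Loc.person 0) = 0) :
    ∃ b, IsBid N E c (s Loc.holding) (s Loc.prices) (s Loc.person 0) b
        (bidProg.run s Loc.holding) ∧
      bidProg.run s Loc.prices = Function.update (s Loc.prices) b (s Loc.prices b + 1) := by
  obtain ⟨hb, hmin⟩ := run_bestObjectProg h hi
  set s₁ := bestObjectProg.run s with hs₁
  have h₁ : ∀ a ∉ bestObjectProg.writes, s₁ a = s a := fun a ha => run_of_notMem_writes ha s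
  have hrel := run_releaseProg (s := s₁) (N := N) (by rw [h₁ _ (by decide), h.nodes])
  set s₂ := releaseProg.run s₁ with hs₂
  have h₂ : ∀ a ∉ releaseProg.writes, s₂ a = s₁ a := fun a ha => run_of_notMem_writes ha s₁
  have hobject : s₂ Loc.object = s₁ Loc.object := h₂ _ (by decide)
  have hperson : s₂ Loc.person = s Loc.person := by rw [h₂ _ (by decide), h₁ _ (by decide)]
  have hprices : s₂ Loc.prices = s Loc.prices := by rw [h₂ _ (by decide), h₁ _ (by decide)]
  have hholding : bidProg.run s Loc.holding =
      Function.update (s₂ Loc.holding) (s Loc.person 0) (s₁ Loc.object 0 + 1) := by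
    simp only [bidProg, run_seq, run_write, eval_cell, eval_add, eval_const]
    rw [Memory.set_of_ne _ (by decide), Memory.set_apply_same, ← hs₁, ← hs₂, hobject, hperson]
  refine ⟨s₁ Loc.object 0, ⟨hi, hb, h0, hmin, ?_, fun i' hi' hne => ?_⟩, ?_⟩
  · rw [hholding, Function.update_self]
  · rw [hholding, Function.update_of_ne hne, hrel i' hi', h₁ _ (by decide)]
  · simp only [bidProg, run_seq, run_write, eval_cell, eval_add, eval_read, eval_const]
    rw [Memory.set_apply_same, Memory.set_of_ne _ (by decide), Memory.set_of_ne _ (by decide),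
      ← hs₁, ← hs₂, hobject, hprices]

theorem run_sweepProg {B r : ℕ} (h : IsAuctionInput N E c s) (hc : ∀ i < N, ∀ j < N, c i j ≤ B)
    (hinv : AuctionInv N E B c (s Loc.holding) (s Loc.prices))
    (hr : r ≤ ∑ j ∈ Finset.range N, s Loc.prices j ∨ ∀ i < N, s Loc.holding i ≠ 0) :
    AuctionInv N E B c (sweepProg.run s Loc.holding) (sweepProg.run s Loc.prices) ∧
      (r + 1 ≤ ∑ j ∈ Finset.range N, sweepProg.run s Loc.prices j ∨
        ∀ i < N, sweepProg.run s Loc.holding i ≠ 0) := by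
  have hsweep := run_forLoop_induction (x := Loc.person) (e := nodes)
    (p := .ite (read Loc.holding (cell Loc.person)) .skip bidProg) (s := s)
    (fun k s' => AuctionInv N E B c (s' Loc.holding) (s' Loc.prices) ∧
      (r + 1 ≤ ∑ j ∈ Finset.range N, s' Loc.prices j ∨ (∀ i < N, s' Loc.holding i ≠ 0) ∨
        r ≤ ∑ j ∈ Finset.range N, s' Loc.prices j ∧ ∀ i < k, s' Loc.holding i ≠ 0)) N
    (by simpa using h.nodes) ?_ ⟨hinv, by simpa using Or.inr hr.symm⟩ ?_
  · obtain ⟨hinv', hlt | hall | ⟨-, hall⟩⟩ := hsweep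
    exacts [⟨hinv', Or.inl hlt⟩, ⟨hinv', Or.inr hall⟩, ⟨hinv', Or.inr hall⟩]
  · intro k s' v hI
    simpa only [Memory.set_of_ne _ (show Loc.holding ≠ Loc.person by decide),
      Memory.set_of_ne _ (show Loc.prices ≠ Loc.person by decide)] using hI
  rintro k hk s' hperson hframe ⟨hinv', hprogress⟩
  rw [run_ite, eval_read, eval_cell, hperson]
  split_ifs with hhold
  · refine ⟨hinv', hprogress.imp_right (Or.imp_right fun ⟨hle, hpos⟩ => ⟨hle, fun i hi => ?_⟩)⟩
    obtain hlt | rfl := Nat.lt_succ_iff_lt_or_eq.1 hi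
    exacts [hpos i hlt, hhold]
  · rw [not_not] at hhold
    have hs' : IsAuctionInput N E c s' := h.congr fun a ha => hframe a (by revert a; decide)
    obtain ⟨b, hbid, hprices⟩ := exists_isBid_run_bidProg hs' (by rwa [hperson])
      (by rwa [hperson])
    rw [hprices]
    refine ⟨hinv'.bid hc hbid, Or.inl ?_⟩
    rw [hbid.sum_update]
    obtain hlt | hall | ⟨hle, -⟩ := hprogress
    exacts [by omega, absurd hhold (hall k hk), by omega]

theorem run_auctionProg (h : IsAuctionInput N E c s) (hE : 0 < E)
    (hc : ∀ i < N, ∀ j < N, c i j ≤ 2 * (N * N) * E) :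
    ∃ π : Equiv.Perm (Fin N), (∀ i : Fin N, auctionProg.run s Loc.holding i = π i + 1) ∧
      ∀ τ : Equiv.Perm (Fin N), ∑ i : Fin N, c i (π i) ≤ ∑ i : Fin N, c i (τ i) + N * E := by
  rw [auctionProg, run_seq, run_seq]
  have hholding := run_mapArray (s := s) (x := Loc.row) (a := Loc.holding) (e := nodes) (p := .skip)
    (v := const 0) N (by simpa using h.nodes) (by decide) (by decide) (by decide) (fun _ => 0)
    fun _ _ _ _ _ _ => rfl
  set s₁ := (mapArray Loc.row Loc.holding nodes .skip (const 0)).run s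
  have h₁ : IsAuctionInput N E c s₁ := h.congr fun a ha => run_of_notMem_writes
    (by revert a; decide) s
  have hprices := run_mapArray (s := s₁) (x := Loc.row) (a := Loc.prices) (e := nodes) (p := .skip)
    (v := const 0) N (by simpa using h₁.nodes) (by decide) (by decide) (by decide) (fun _ => 0)
    fun _ _ _ _ _ _ => rfl
  set s₂ := (mapArray Loc.row Loc.prices nodes .skip (const 0)).run s₁ with hs₂
  have h₂ : IsAuctionInput N E c s₂ := h₁.congr fun a ha => run_of_notMem_writes
    (by revert a; decide) s₁
  rw [← run_of_notMem_writes (c := mapArray Loc.row Loc.prices nodes .skip (const 0))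
    (by decide) s₁, ← hs₂] at hholding
  obtain ⟨hinv, hprogress⟩ := run_forLoop_induction (x := Loc.sweep)
    (e := const 4 * (nodes * nodes * nodes)) (p := sweepProg) (s := s₂)
    (fun r s' => AuctionInv N E (2 * (N * N) * E) c (s' Loc.holding) (s' Loc.prices) ∧
      (r ≤ ∑ j ∈ Finset.range N, s' Loc.prices j ∨ ∀ i < N, s' Loc.holding i ≠ 0))
    (4 * (N * N * N)) (by simp [← h₂.nodes])
    (fun r s' v hI => by
      simpa only [Memory.set_of_ne _ (show Loc.holding ≠ Loc.sweep by decide),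
        Memory.set_of_ne _ (show Loc.prices ≠ Loc.sweep by decide)] using hI)
    ⟨.initial hholding hprices, Or.inl (Nat.zero_le _)⟩
    fun r _ s' _ hframe ⟨hinv, hr⟩ =>
      run_sweepProg (h₂.congr fun a ha => hframe a (by revert a; decide)) hc hinv hr
  -- the prices are bounded, so they cannot rise in every one of the sweeps
  have hall := hprogress.resolve_left fun hle => by
    have hsum := hinv.sum_le hE
    have hN := h.nodes
    nlinarith [Nat.mul_pos (show 0 < N by omega) (show 0 < N by omega)]
  obtain ⟨π, hπ⟩ := hinv.exists_perm hall
  exact ⟨π, hπ, hinv.sum_slack hπ⟩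

end NoWaitFlowshop

/-! ### The program: rounds and output -/

namespace NoWaitFlowshop

open RAM RAM.Cmd RAM.Expr

def keyExpr (x : Expr) : Expr := entry Loc.delays x jobs * nodes + (jobs - x)

/-- The comparison of the node in `row` with the next node of its cycle. -/
def selectStep : Cmd :=
  .seq (assign Loc.node (read Loc.holding (cell Loc.node) - const 1)) <|
  assignIf (keyExpr (cell Loc.row) - keyExpr (cell Loc.node)) Loc.acc (const 0)

/-- The node in `row` is deactivated unless it is a leader. -/
def selectEntry : Cmd :=
  .seq (assign Loc.acc (read Loc.active (cell Loc.row))) <|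
  .seq (assign Loc.node (cell Loc.row)) <| .forLoop Loc.col nodes selectStep

def selectProg : Cmd := mapArray Loc.row Loc.active nodes selectEntry (cell Loc.acc)

/-- Replaces `ν` by `π * ν`, where the auction has left `π x + 1` in cell `x` of `holding`. -/
def composeProg : Cmd :=
  mapArray Loc.row Loc.perm nodes .skip
    (read Loc.holding (read Loc.perm (cell Loc.row)) - const 1)

def coverProg : Cmd := .seq coverCostProg auctionProg

/-- After `r` rounds, `power` contains `2 ^ r`. -/
def roundProg : Cmd :=
  .seq coverProg <| .seq composeProg <| .seq selectProg <|
  assign Loc.power (cell Loc.power + cell Loc.power)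

/-- The image of the node in `row` after the exchange of the node in `round` with the dummy job. -/
def joinEntry : Cmd :=
  .seq (assign Loc.acc (read Loc.perm (cell Loc.row))) <|
  .ite ((cell Loc.acc).neq (cell Loc.round))
    (.ite ((cell Loc.acc).neq jobs) .skip (assign Loc.acc (cell Loc.round)))
    (assign Loc.acc jobs)

/-- Multiplication with the transposition of an active job and the dummy job joins their cycles. -/
def joinProg : Cmd :=
  .seq (mapArray Loc.row Loc.perm nodes joinEntry (cell Loc.acc)) <|
  .write Loc.active (cell Loc.round) (const 0)

def prepareProg : Cmd := .seq delaysProg incrementProg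

def resetPermProg : Cmd := mapArray Loc.row Loc.perm nodes .skip (cell Loc.row)

def activateProg : Cmd := mapArray Loc.row Loc.active nodes .skip (const 1)

def setupProg : Cmd :=
  .seq prepareProg <| .seq resetPermProg <| .seq activateProg <| assign Loc.power (const 1)

/-- The rounds; `⌈log₂ m⌉` of them are executed. -/
def roundsProg : Cmd :=
  .forLoop Loc.round machines (.ite (machines - cell Loc.power) roundProg .skip)

def joinsProg : Cmd :=
  .forLoop Loc.round jobs (.ite (read Loc.active (cell Loc.round)) joinProg .skip)

def outputProg : Cmd :=
  .seq (assign Loc.node jobs) <|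
  .forLoop Loc.round jobs
    (.seq (assign Loc.node (read Loc.perm (cell Loc.node))) <|
      .write Loc.output (cell Loc.round) (cell Loc.node))

/-- The approximation algorithm on an instance with at least one job. -/
def orderProg : Cmd := .seq setupProg <| .seq roundsProg <| .seq joinsProg outputProg

theorem polyTime_orderProg : orderProg.PolyTime := polyTime_of_wf (by decide) (by decide)

variable {I : NoWaitFlowshop} {s : Memory}

/-- The array `p` contains the permutation `ν` of the nodes. -/
def Represents (p : ℕ → ℕ) (ν : Equiv.Perm I.Node) : Prop := ∀ x : I.Node, p x = ν x

/-- The state of the program after `r` rounds; the tour of every job order serves as a bound. -/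
structure RoundState (I : NoWaitFlowshop) (r : ℕ) (ν : Equiv.Perm I.Node) (s : Memory) : Prop
    extends Prepared I s where
  perm : Represents (s Loc.perm) ν
  power : s Loc.power 0 = 2 ^ r
  inv (τ : Equiv.Perm (Fin I.n)) :
    I.RoundInv (arcCost I.dist (tour τ)) r ν (I.activeSet (s Loc.active))

/-- The state of the program after `r` rounds when the jobs before `k` are joined with the dummy
job. -/
structure JoinState (I : NoWaitFlowshop) (r k : ℕ) (ν : Equiv.Perm I.Node) (s : Memory) : Prop
    extends IsInput I s where
  perm : Represents (s Loc.perm) ν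
  inv (τ : Equiv.Perm (Fin I.n)) :
    I.JoinInv ((3 * r + 1) * arcCost I.dist (tour τ)) k ν (I.activeSet (s Loc.active))

theorem Prepared.eval_keyExpr (h : I.Prepared s) {e : Expr} (he : e.eval s < I.n + 1) :
    (keyExpr e).eval s = I.key (e.eval s) := by
  rw [keyExpr, eval_add, eval_mul, eval_sub, eval_entry, eval_nodes, eval_jobs, h.jobs,
    h.delays _ he _ I.n.lt_succ_self, delay_of_le_right _ le_rfl, key]

theorem run_selectStep (h : I.Prepared s) {π : Equiv.Perm I.Node}
    (hπ : ∀ x : I.Node, s Loc.holding x = π x + 1) {x y : I.Node} (hrow : s Loc.row 0 = x)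
    (hnode : s Loc.node 0 = y) : selectStep.run s Loc.node 0 = π y ∧
      selectStep.run s Loc.acc 0 = if I.key x ≤ I.key (π y) then s Loc.acc 0 else 0 := by
  have hnext : (read Loc.holding (cell Loc.node) - const 1).eval s = π y := by
    rw [eval_sub, eval_read, eval_cell, hnode, hπ, eval_const, Nat.add_sub_cancel]
  rw [selectStep, run_seq, run_assign, hnext, run_assignIf]
  set s₁ := s.set Loc.node 0 (π y)
  have hframe : ∀ a ≠ Loc.node, s₁ a = s a := fun a ha => Memory.set_of_ne s ha 0 _
  have h₁ : I.Prepared s₁ := h.congr fun a ha => hframe a (by revert a; decide)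
  have hrow₁ : (cell Loc.row).eval s₁ = x := by rw [eval_cell, hframe _ (by decide), hrow]
  have hnode₁ : (cell Loc.node).eval s₁ = π y := by simp [s₁]
  rw [eval_sub, h₁.eval_keyExpr (hrow₁ ▸ x.2), h₁.eval_keyExpr (hnode₁ ▸ (π y).2), hrow₁, hnode₁,
    eval_const, Memory.set_of_ne s₁ (by decide), Memory.set_apply_same, Function.update_self,
    hframe Loc.acc (by decide)]
  refine ⟨hnode₁, ?_⟩
  simp only [Nat.sub_eq_zero_iff_le]

theorem run_selectEntry (h : I.Prepared s) {π : Equiv.Perm I.Node}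
    (hπ : ∀ x : I.Node, s Loc.holding x = π x + 1) {x : I.Node} (hrow : s Loc.row 0 = x) :
    selectEntry.run s Loc.acc 0 =
      if ∀ y, π.SameCycle x y → I.key x ≤ I.key y then s Loc.active x else 0 := by
  rw [selectEntry, run_seq, run_seq]
  obtain ⟨-, hacc⟩ := run_forLoop_induction (x := Loc.col) (e := nodes) (p := selectStep)
    (s := (assign Loc.node (cell Loc.row)).run
      ((assign Loc.acc (read Loc.active (cell Loc.row))).run s))
    (fun k s' => s' Loc.node 0 = (π ^ k) x ∧ s' Loc.acc 0 =
      if ∀ i ≤ k, I.key x ≤ I.key ((π ^ i) x) then s Loc.active x else 0) (I.n + 1)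
    (by simp [h.jobs]) (fun k s' v hI => by simpa using hI) (by simp [hrow]) (by
      rintro k - s' - hframe ⟨hnode, hacc⟩
      have hs' : ∀ a ∈ [Loc.input, Loc.delays, Loc.step, Loc.holding, Loc.row], s' a = s a :=
        fun a ha => by
          rw [hframe a (by revert a; decide), run_assign, run_assign,
            Memory.set_of_ne _ (by revert a; decide), Memory.set_of_ne _ (by revert a; decide)]
      obtain ⟨hnode', hacc'⟩ := run_selectStep (h.congr fun a ha => hs' a (by revert a; decide))
        (by rwa [hs' _ (by decide)]) (by rwa [hs' _ (by decide)]) hnode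
      rw [hnode', hacc', hacc, pow_succ', Equiv.Perm.mul_apply, ← ite_and]
      refine ⟨rfl, if_congr ?_ rfl rfl⟩
      simp only [← Equiv.Perm.mul_apply, ← pow_succ', ← Nat.lt_succ_iff (m := _),
        Nat.forall_lt_succ_right (n := k + 1), and_comm])
  rw [hacc]
  refine if_congr ⟨fun hall y hxy => ?_, fun hall i _ => hall _ ⟨i, by simp⟩⟩ rfl rfl
  obtain ⟨i, hi, rfl⟩ := sameCycle_iff_exists_pow_lt_card.1 hxy
  exact hall i (hi.le.trans_eq (Fintype.card_fin _))

theorem activeSet_run_selectProg (h : I.Prepared s) {π : Equiv.Perm I.Node}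
    (hπ : ∀ x : I.Node, s Loc.holding x = π x + 1) :
    I.activeSet (selectProg.run s Loc.active) = leaders (I.activeSet (s Loc.active)) π := by
  ext x
  rw [mem_activeSet, selectProg, run_mapArray_fin (by simp [h.jobs]) (by decide) (by decide)
    (by decide) (fun x : I.Node => if ∀ y, π.SameCycle x y → I.key x ≤ I.key y
      then s Loc.active x else 0) _ x, leaders, Finset.mem_filter, mem_activeSet]
  · split_ifs with hlead
    · exact (and_iff_left hlead).symm
    · exact iff_of_false (fun h0 => h0 rfl) fun h0 => hlead h0.2
  · intro i s' hrow hframe hactive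
    rw [eval_cell, run_selectEntry (h.congr fun a ha => hframe a (by revert a; decide))
      (by rwa [hframe _ (by decide)]) hrow, hactive]

theorem represents_run_composeProg (h : I.IsInput s) {ν π : Equiv.Perm I.Node}
    (hν : Represents (s Loc.perm) ν) (hπ : ∀ x : I.Node, s Loc.holding x = π x + 1) :
    Represents (composeProg.run s Loc.perm) (π * ν) := by
  refine run_mapArray_fin (by simp [h.jobs]) (by decide) (by decide) (by decide) _
    fun x s' hrow hframe hperm => ?_
  rw [run_skip, eval_sub, eval_read, eval_read, eval_cell, hrow, hperm, hν, hframe _ (by decide),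
    hπ, eval_const, Nat.add_sub_cancel, Equiv.Perm.mul_apply]

theorem exists_isCycleCover_run_coverProg {r : ℕ} {ν : Equiv.Perm I.Node}
    (h : I.RoundState r ν s) : ∃ π : Equiv.Perm I.Node,
      (∀ x : I.Node, coverProg.run s Loc.holding x = π x + 1) ∧
      I.IsCycleCover (I.activeSet (s Loc.active)) π ∧
      ∀ τ : Equiv.Perm (Fin I.n), arcCost I.dist π ≤ 3 * arcCost I.dist (tour τ) := by
  set s₁ := coverCostProg.run s
  have h₁ : ∀ a ∉ coverCostProg.writes, s₁ a = s a := fun a ha => run_of_notMem_writes ha s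
  have hinput : IsAuctionInput (I.n + 1) I.increment (I.coverCost (s Loc.active)) s₁ :=
    { nodes := by rw [h₁ _ (by decide), h.jobs]
      increment := by rw [h₁ _ (by decide), h.increment]
      costs := run_coverCostProg h.toPrepared }
  obtain ⟨π, hπ, hopt⟩ := run_auctionProg hinput (Nat.succ_pos _)
    fun i hi j _ => coverCost_le _ hi j
  have hcover (τ : Equiv.Perm (Fin I.n)) := isCycleCover_and_arcCost_le (isTourAlong_tour τ)
    (h.inv τ).last_mem hopt
  exact ⟨π, hπ, (hcover 1).1, fun τ => (hcover τ).2⟩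

theorem exists_roundState_run_roundProg {r : ℕ} {ν : Equiv.Perm I.Node}
    (h : I.RoundState r ν s) : ∃ ν', I.RoundState (r + 1) ν' (roundProg.run s) := by
  obtain ⟨π, hπ, hcover, hcost⟩ := exists_isCycleCover_run_coverProg h
  rw [roundProg, run_seq, run_seq, run_seq]
  have h₁ : ∀ a ∉ coverProg.writes, coverProg.run s a = s a :=
    fun a ha => run_of_notMem_writes ha s
  generalize coverProg.run s = s₁ at hπ h₁ ⊢
  have hprep₁ : I.Prepared s₁ := h.toPrepared.congr fun a ha => h₁ a (by revert a; decide)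
  have hperm := represents_run_composeProg hprep₁.toIsInput
    (by rw [h₁ _ (by decide)]; exact h.perm) hπ
  have h₂ : ∀ a ∉ composeProg.writes, composeProg.run s₁ a = s₁ a :=
    fun a ha => run_of_notMem_writes ha s₁
  generalize composeProg.run s₁ = s₂ at hperm h₂ ⊢
  have hprep₂ : I.Prepared s₂ := hprep₁.congr fun a ha => h₂ a (by revert a; decide)
  have hactive := activeSet_run_selectProg hprep₂ (π := π) (by rwa [h₂ _ (by decide)])
  rw [h₂ _ (by decide), h₁ _ (by decide)] at hactive
  have h₃ : ∀ a ∉ selectProg.writes, selectProg.run s₂ a = s₂ a :=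
    fun a ha => run_of_notMem_writes ha s₂
  generalize selectProg.run s₂ = s₃ at hactive h₃ ⊢
  rw [run_assign]
  refine ⟨π * ν, hprep₂.congr fun a ha => ?_, ?_, ?_, fun τ => ?_⟩
  · rw [Memory.set_of_ne _ (by revert a; decide), h₃ a (by revert a; decide)]
  · rwa [Memory.set_of_ne _ (by decide), h₃ _ (by decide)]
  · rw [Memory.set_apply_same, Function.update_self, eval_add, eval_cell, h₃ _ (by decide),
      h₂ _ (by decide), h₁ _ (by decide), h.power]
    ring
  · rw [Memory.set_of_ne _ (by decide), hactive]
    exact (h.inv τ).mul hcover (hcost τ)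

theorem RoundState.set_round {r : ℕ} {ν : Equiv.Perm I.Node} (h : I.RoundState r ν s) (v : ℕ) :
    I.RoundState r ν (s.set Loc.round 0 v) where
  toPrepared := h.toPrepared.congr fun a ha => Memory.set_of_ne s (by revert a; decide) 0 v
  perm := by rw [Memory.set_of_ne _ (by decide)]; exact h.perm
  power := by rw [Memory.set_of_ne _ (by decide)]; exact h.power
  inv τ := by rw [Memory.set_of_ne _ (by decide)]; exact h.inv τ

theorem JoinState.set_round {r k : ℕ} {ν : Equiv.Perm I.Node} (h : I.JoinState r k ν s) (v : ℕ) :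
    I.JoinState r k ν (s.set Loc.round 0 v) where
  toIsInput := h.toIsInput.congr (Memory.set_of_ne s (by decide) 0 v)
  perm := by rw [Memory.set_of_ne _ (by decide)]; exact h.perm
  inv τ := by rw [Memory.set_of_ne _ (by decide)]; exact h.inv τ

theorem RoundState.joinState {r : ℕ} {ν : Equiv.Perm I.Node} (h : I.RoundState r ν s)
    (hr : I.m ≤ 2 ^ r) : I.JoinState r 0 ν s where
  toIsInput := h.toIsInput
  perm := h.perm
  inv τ := (h.inv τ).joinInv (isTourAlong_tour τ) hr

theorem prepared_run_prepareProg (h : I.IsInput s) : I.Prepared (prepareProg.run s) := by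
  rw [prepareProg, run_seq]
  have hdelays := run_delaysProg h
  have hinput : I.IsInput (delaysProg.run s) :=
    h.congr (run_of_notMem_writes (by decide) s)
  generalize delaysProg.run s = s₁ at hdelays hinput ⊢
  exact
    { toIsInput := hinput.congr (run_of_notMem_writes (by decide) s₁)
      delays := by rwa [run_of_notMem_writes (by decide)]
      increment := run_incrementProg hinput hdelays }

theorem represents_run_resetPermProg (h : I.IsInput s) :
    Represents (resetPermProg.run s Loc.perm) (1 : Equiv.Perm I.Node) :=
  run_mapArray_fin (by simp [h.jobs]) (by decide) (by decide) (by decide) _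
    fun _ _ hrow _ _ => hrow

theorem activeSet_run_activateProg (h : I.IsInput s) :
    I.activeSet (activateProg.run s Loc.active) = Finset.univ := by
  have hone : ∀ x : I.Node, activateProg.run s Loc.active x = 1 :=
    run_mapArray_fin (by simp [h.jobs]) (by decide) (by decide) (by decide) _
      fun _ _ _ _ _ => rfl
  exact Finset.eq_univ_iff_forall.2 fun x => mem_activeSet.2 (by simp [hone])

theorem roundState_run_setupProg (h : I.IsInput s) : I.RoundState 0 1 (setupProg.run s) := by
  rw [setupProg, run_seq, run_seq, run_seq]
  have hprep₁ := prepared_run_prepareProg h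
  generalize prepareProg.run s = s₁ at hprep₁ ⊢
  have hperm := represents_run_resetPermProg hprep₁.toIsInput
  have h₂ : ∀ a ∉ resetPermProg.writes, resetPermProg.run s₁ a = s₁ a :=
    fun a ha => run_of_notMem_writes ha s₁
  generalize resetPermProg.run s₁ = s₂ at hperm h₂ ⊢
  have hprep₂ : I.Prepared s₂ := hprep₁.congr fun a ha => h₂ a (by revert a; decide)
  have hactive := activeSet_run_activateProg hprep₂.toIsInput
  have h₃ : ∀ a ∉ activateProg.writes, activateProg.run s₂ a = s₂ a :=
    fun a ha => run_of_notMem_writes ha s₂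
  generalize activateProg.run s₂ = s₃ at hactive h₃ ⊢
  rw [run_assign]
  refine ⟨hprep₂.congr fun a ha => ?_, ?_, by simp, fun τ => ?_⟩
  · rw [Memory.set_of_ne _ (by revert a; decide), h₃ a (by revert a; decide)]
  · rwa [Memory.set_of_ne _ (by decide), h₃ _ (by decide)]
  · rw [Memory.set_of_ne _ (by decide), hactive]
    exact RoundInv.initial _

theorem exists_joinState_run_roundsProg (h : I.RoundState 0 1 s) :
    ∃ ν r, 2 ^ r < 2 * I.m ∧ I.JoinState r 0 ν (roundsProg.run s) := by
  obtain ⟨ν, r, hstate, hr, hm⟩ := run_forLoop_induction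
    (x := Loc.round) (e := machines) (p := .ite (machines - cell Loc.power) roundProg .skip)
    (s := s) (fun k s' => ∃ ν r, I.RoundState r ν s' ∧ 2 ^ r < 2 * I.m ∧ (I.m ≤ 2 ^ r ∨ k ≤ r))
    I.m h.machines (fun k s' v ⟨ν, r, hstate, hr⟩ => ⟨ν, r, hstate.set_round v, hr⟩)
    ⟨1, 0, h, by have := I.m_pos; omega, Or.inr le_rfl⟩ (by
      rintro k - s' - - ⟨ν, r, hstate, hr, hm⟩
      rw [run_ite, eval_sub, eval_machines, eval_cell, hstate.machines, hstate.power]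
      split_ifs with hlt
      · obtain ⟨ν', hstate'⟩ := exists_roundState_run_roundProg hstate
        exact ⟨ν', r + 1, hstate', by rw [pow_succ]; omega, Or.inr (by omega)⟩
      · exact ⟨ν, r, hstate, hr, Or.inl (by omega)⟩)
  exact ⟨ν, r, hr, hstate.joinState (hm.elim id fun hle => hle.trans Nat.lt_two_pow_self.le)⟩

theorem run_joinEntry (h : I.IsInput s) {k : Fin I.n} (hk : s Loc.round 0 = k) {y : I.Node}
    (hy : s Loc.perm (s Loc.row 0) = y) :
    joinEntry.run s Loc.acc 0 = swap k.castSucc (Fin.last _) y := by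
  have hne : (k : ℕ) ≠ I.n := k.2.ne
  rw [joinEntry, run_seq, run_assign, eval_read, eval_cell, hy, Equiv.swap_apply_def, run_ite,
    run_ite]
  simp only [ne_eq, eval_neq_eq_zero, eval_cell, eval_jobs, Memory.set_apply, hk, h.jobs,
    Fin.ext_iff, Fin.val_castSucc, Fin.val_last]
  split_ifs <;> simp_all [h.jobs]

theorem represents_run_joinProg (h : I.IsInput s) {ν : Equiv.Perm I.Node}
    (hν : Represents (s Loc.perm) ν) {k : Fin I.n} (hk : s Loc.round 0 = k) :
    Represents (joinProg.run s Loc.perm) (swap k.castSucc (Fin.last _) * ν) := by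
  rw [joinProg, run_seq, run_write, Memory.set_of_ne _ (by decide)]
  refine run_mapArray_fin (by simp [h.jobs]) (by decide) (by decide) (by decide) _
    fun x s' hrow hframe hperm => ?_
  exact run_joinEntry (h.congr (hframe _ (by decide))) (by rwa [hframe _ (by decide)])
    (by rw [hrow, hperm, hν])

theorem activeSet_run_joinProg {k : Fin I.n} (hk : s Loc.round 0 = k) :
    I.activeSet (joinProg.run s Loc.active) = (I.activeSet (s Loc.active)).erase k.castSucc := by
  rw [joinProg, run_seq, run_write, Memory.set_apply_same, eval_cell, eval_const,
    run_of_notMem_writes (by decide), run_of_notMem_writes (by decide), hk]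
  ext x
  rw [mem_activeSet, Finset.mem_erase, mem_activeSet, Function.update_apply]
  simp [Fin.ext_iff, ← not_or]

theorem JoinState.run_joinProg {r : ℕ} {k : Fin I.n} {ν : Equiv.Perm I.Node}
    (h : I.JoinState r k ν s) (hk : s Loc.round 0 = k) (hactive : s Loc.active k ≠ 0) :
    I.JoinState r (k + 1) (swap k.castSucc (Fin.last _) * ν) (joinProg.run s) where
  toIsInput := h.toIsInput.congr (run_of_notMem_writes (by decide) s)
  perm := represents_run_joinProg h.toIsInput h.perm hk
  inv τ := by
    rw [activeSet_run_joinProg hk]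
    exact (h.inv τ).succ_of_mem (mem_activeSet.2 hactive)

theorem exists_joinState_run_joinsProg {r : ℕ} {ν : Equiv.Perm I.Node}
    (h : I.JoinState r 0 ν s) : ∃ ν', I.JoinState r I.n ν' (joinsProg.run s) := by
  refine run_forLoop_induction (fun k s' => ∃ ν', I.JoinState r k ν' s') I.n h.jobs
    (fun k s' v ⟨ν', hstate⟩ => ⟨ν', hstate.set_round v⟩) ⟨ν, h⟩ ?_
  rintro k hk s' hround - ⟨ν', hstate⟩
  rw [run_ite, eval_read, eval_cell, hround]
  split_ifs with hactive
  · exact ⟨_, hstate.run_joinProg (k := ⟨k, hk⟩) hround hactive⟩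
  · exact ⟨ν', hstate.toIsInput, hstate.perm, fun τ =>
      (hstate.inv τ).succ_of_notMem (k := ⟨k, hk⟩) fun hmem => hactive (mem_activeSet.1 hmem)⟩

theorem run_outputProg (h : I.IsInput s) {ν : Equiv.Perm I.Node}
    (hν : Represents (s Loc.perm) ν) :
    ∀ k < I.n, outputProg.run s Loc.output k = (ν ^ (k + 1)) (Fin.last _) := by
  rw [outputProg, run_seq]
  refine (run_forLoop_induction (I := fun k s' => s' Loc.node 0 = (ν ^ k) (Fin.last _) ∧
    ∀ i < k, s' Loc.output i = (ν ^ (i + 1)) (Fin.last _)) I.n (by simp [h.jobs]) ?_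
    (by simp [h.jobs]) ?_).2
  · intro k s' v hI
    simpa using hI
  · rintro k hk s' hround hframe ⟨hnode, hout⟩
    have hperm : s' Loc.perm = s Loc.perm := by
      rw [hframe _ (by decide), run_assign, Memory.set_of_ne _ (by decide)]
    have hnext : s' Loc.perm (s' Loc.node 0) = (ν ^ (k + 1)) (Fin.last _) := by
      rw [hperm, hnode, hν, pow_succ', Equiv.Perm.mul_apply]
    refine ⟨by simp [hnext], fun i hi => ?_⟩
    obtain hlt | rfl := Nat.lt_succ_iff_lt_or_eq.1 hi
    · simpa [hround, hlt.ne] using hout i hlt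
    · simp [hround, hnext]

theorem exists_isCycleOn_run_orderProg (h : I.IsInput s) :
    ∃ (ν : Equiv.Perm I.Node) (r : ℕ), 2 ^ r < 2 * I.m ∧
      (∀ τ : Equiv.Perm (Fin I.n), arcCost I.dist ν ≤ (3 * r + 1) * arcCost I.dist (tour τ)) ∧
      ν.IsCycleOn (Finset.univ : Finset I.Node) ∧
      ∀ k < I.n, orderProg.run s Loc.output k = (ν ^ (k + 1)) (Fin.last _) := by
  obtain ⟨ν₀, r, hr, hjoin⟩ := exists_joinState_run_roundsProg (roundState_run_setupProg h)
  obtain ⟨ν, hν⟩ := exists_joinState_run_joinsProg hjoin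
  exact ⟨ν, r, hr, fun τ => (hν.inv τ).cost_le, (hν.inv 1).isCycleOn,
    run_outputProg hν.toIsInput hν.perm⟩

end NoWaitFlowshop

/-! ### The performance guarantee -/

namespace RAM

theorem length_le_bitLength (w : List ℕ) : w.length ≤ bitLength w := by
  simp [bitLength]

theorem size_initMem_le (w : List ℕ) (a i : ℕ) : Nat.size (initMem w a i) ≤ bitLength w := by
  rw [initMem]
  split_ifs
  · by_cases hi : i < w.length
    · rw [List.getD_eq_getElem _ _ hi]
      exact (Nat.le_succ _).trans (List.single_le_sum (by simp) _
        (List.mem_map.2 ⟨w[i], List.getElem_mem hi, rfl⟩))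
    · rw [List.getD_eq_default _ _ (not_lt.1 hi), Nat.size_zero]
      exact Nat.zero_le _
  · simp

end RAM

theorem three_mul_add_one_le_max_logb {m r : ℕ} (hr : 2 ^ r < 2 * m) :
    (3 * r + 1 : ℝ) ≤ max 1 (7 * Real.logb 2 m) := by
  obtain rfl | hr0 := Nat.eq_zero_or_pos r
  · simp
  have hm : 2 ≤ m := by
    have := Nat.pow_le_pow_right two_pos hr0
    omega
  have hm0 : (m : ℝ) ≠ 0 := by positivity
  have hlog : 1 ≤ Real.logb 2 m := by
    rw [Real.le_logb_iff_rpow_le one_lt_two (by positivity), Real.rpow_one]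
    exact_mod_cast hm
  have hr_le : (r : ℝ) ≤ 1 + Real.logb 2 m := by
    rw [← Real.logb_self_eq_one one_lt_two, ← Real.logb_mul two_ne_zero hm0,
      Real.le_logb_iff_rpow_le one_lt_two (by positivity), Real.rpow_natCast]
    exact_mod_cast hr.le
  exact le_max_of_le_right (by linarith)

namespace NoWaitFlowshop

open RAM

variable (I : NoWaitFlowshop)

theorem mul_le_bitLength : I.n * I.m ≤ bitLength I.encode := by
  refine le_trans ?_ (length_le_bitLength _)
  rw [encode, flatten_ofFn_ofFn_eq, List.length_cons, List.length_cons, List.length_ofFn]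
  omega

theorem bounded_initMem (hn : 0 < I.n) :
    (initMem I.encode).Bounded (bitLength I.encode) (bitLength I.encode) where
  fst_le := (Nat.le_mul_of_pos_right _ I.m_pos).trans I.mul_le_bitLength
  snd_le := (Nat.le_mul_of_pos_left _ hn).trans I.mul_le_bitLength
  size_le := size_initMem_le _

/-- Without jobs, the loop over `machines` in `orderProg` would not be polynomial in the length of
the input, hence the test. -/
def scheduleProg : Prog := .ite (.read 0 (.const 0)) orderProg.compile .skip

theorem exists_exec_scheduleProg : ∃ time : Polynomial ℕ, ∀ I : NoWaitFlowshop, ∃ t s,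
    Exec scheduleProg (initMem I.encode) t s ∧ t ≤ time.eval (bitLength I.encode) ∧
      (0 < I.n → s = orderProg.run (initMem I.encode)) := by
  obtain ⟨_, time, hrun⟩ := polyTime_orderProg
  refine ⟨time.comp (2 * Polynomial.X) + 2 * Polynomial.X + 5, fun I => ?_⟩
  have htest : Nat.size (initMem I.encode 0 0) ≤ bitLength I.encode := size_initMem_le _ _ _
  simp only [Polynomial.eval_add, Polynomial.eval_mul, Polynomial.eval_X, Polynomial.eval_ofNat,
    Polynomial.eval_comp]
  obtain hn | hn := Nat.eq_zero_or_pos I.n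
  · refine ⟨_, _, Exec.ite_false hn (Exec.skip _), ?_, fun h => absurd hn h.ne'⟩
    simp only [Expr.cost, Expr.eval, Nat.size_zero]
    omega
  · obtain ⟨⟨t, ht, htime⟩, -⟩ := hrun _ _ _ (I.bounded_initMem hn)
    rw [← two_mul] at htime
    refine ⟨_, _, Exec.ite_true hn.ne' ht, ?_, fun _ => rfl⟩
    simp only [Expr.cost, Expr.eval, Nat.size_zero]
    omega

variable {I}

theorem IsFeasible.isApproximate {σ : Equiv.Perm (Fin I.n)} {S : I.Schedule}
    (hS : I.IsFeasible σ S) {c : ℕ} {ρ : ℝ} (hc : c ≤ ρ)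
    (hcost : ∀ τ : Equiv.Perm (Fin I.n), I.makespan S ≤ (c * arcCost I.dist (tour τ) : ℕ)) :
    I.IsApproximate ρ σ := by
  refine ⟨S, hS, fun τ S' hS' => ?_⟩
  calc (I.makespan S : ℝ)
      ≤ c * arcCost I.dist (tour τ) := by exact_mod_cast hcost τ
    _ ≤ c * I.makespan S' := by gcongr; exact_mod_cast hS'.arcCost_tour_le_makespan
    _ ≤ ρ * I.makespan S' := by gcongr

theorem exists_isOutput_run_orderProg_isApproximate (I : NoWaitFlowshop) :
    ∃ σ, I.IsOutput (orderProg.run (initMem I.encode)) σ ∧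
      I.IsApproximate (max 1 (7 * Real.logb 2 I.m)) σ := by
  obtain ⟨ν, r, hr, hcost, hν, hout⟩ := exists_isCycleOn_run_orderProg (I := I) ⟨rfl⟩
  obtain ⟨σ, hσ, S, hS, hmakespan⟩ := exists_isFeasible_of_isCycleOn hν
  refine ⟨σ, fun k => by rw [hout k k.2, hσ]; rfl, hS.isApproximate (c := 3 * r + 1) ?_ fun τ => ?_⟩
  · exact_mod_cast three_mul_add_one_le_max_logb hr
  · exact hmakespan.trans (by exact_mod_cast hcost τ)

end NoWaitFlowshop

theorem mainTheorem3 :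
    ∃ (C : ℝ) (P : RAM.Prog),
      IsNoWaitFlowshopApproximation P (fun m => max 1 (C * Real.logb 2 (m : ℝ))) := by
  obtain ⟨time, htime⟩ := NoWaitFlowshop.exists_exec_scheduleProg
  refine ⟨7, NoWaitFlowshop.scheduleProg, time, fun I => ?_⟩
  obtain ⟨t, s, hexec, ht, hs⟩ := htime I
  obtain ⟨σ, hσ, happrox⟩ := I.exists_isOutput_run_orderProg_isApproximate
  exact ⟨t, s, σ, hexec, ht, fun k => hs k.pos ▸ hσ k, happrox⟩
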